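/- **Agents and exosystems.** Consider $n$ agents $\dot x_i=A_ix_i+B_iu_i$ with individual exosystems $\dot\omega_i=S_i\omega_i$ ($x_i\in\mathbb R^{n_i}$, $\omega_i\in\mathbb R^{q_i}$, $i=1,\dots,n$), and a group exosystem (leader) $\dot x_0=A_0x_0$, $x_0\in\mathbb R^{n_0}$. The outputs are $y_{si}=C_{si}x_i+C_{wi}\omega_i\in\mathbb R^{p_1}$, $y_{di}=C_{di}x_i\in\mathbb R^{p_2}$ and $y_{d0}=C_0x_0\in\mathbb R^{p_2}$. Assume that the pairs $\left(A_i,\begin{bmatrix}C_{si}\\C_{di}\end{bmatrix}\right)$, $(S_i,C_{wi})$ and $(A_0,C_0)$ are observable. Put $p=p_1+p_2$ and $\bar n=n_0+\max_i(n_i+q_i)$. **Transformed states.** Let $\bar x_i=W_i\,(x_i,\omega_i,x_0)$ be a transformation removing the redundant modes: $W_i$ is onto, its kernel is exactly the unobservable subspace of the compact system with state $(x_i,\omega_i,x_0)$ and output $(y_{si},\,y_{di}-y_{d0})$, and in the new state the system has the form $$\dot{\bar x}_i=\bar A_i\bar x_i+\bar B_iu_i,\qquad \begin{bmatrix}y_{si}\\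 y_{di}-y_{d0}\end{bmatrix}=\bar C_i\bar x_i,$$ $$\bar A_i=\begin{bmatrix}A_i&\bar A_{i12}\\0&\bar A_{i22}\end{bmatrix},\qquad \bar B_i=\begin{bmatrix}B_i\\0\end{bmatrix},\qquad \bar C_i=\begin{bmatrix}C_{si}&\bar C_{i21}\\C_{di}&\bar C_{i22}\end{bmatrix}.$$ Let $T_i$ be the matrix with block rows $\bar C_i,\bar C_i\bar A_i,\dots,\bar C_i\bar A_i^{\bar n-1}$, and put $\chi_i=T_i\bar x_i\in\mathbb R^{p\bar n}$, $\mathcal B_i=T_i\bar B_i$, $\mathcal A=\begin{bmatrix}0&I_{p(\bar n-1)}\\0&0\end{bmatrix}$ and $\mathcal C=\begin{bmatrix}I_p&0\end{bmatrix}$. Let $\mathcal C_1$ and $\mathcal C_2$ be the first $p_1$ and the last $p_2$ rows of $\mathcal C$. Let $\mathcal L_i=\begin{bmatrix}0\\L_i\end{bmatrix}$ with $L_i\in\mathbb R^{p\times p\bar n}$ such that $T_i\bar A_i=(\mathcal A+\mathcal L_i)T_i$; thus $\dot\chi_i=(\mathcal A+\mathcal L_i)\chi_i+\mathcal B_iu_i$.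 **Graphs.** Let $\bar G_1,\dots,\bar G_\delta$ be weighted directed graphs on the nodes $0,1,\dots,n$ with nonnegative weights $a_{ij}$, where $a_{ij}>0$ iff $(j,i)$ is an edge, $a_{ii}=0$ and $a_{0j}=0$. Let $\emptyset\neq\Gamma_c\subseteq\{1,\dots,\delta\}$ be such that for $k\in\Gamma_c$ the graph $\bar G_k$ contains a directed spanning tree rooted at the leader $0$, and let $\Gamma_d$ be the set of the remaining indices. Let $L^{(k)}\in\mathbb R^{n\times n}$ be the grounded Laplacian of $\bar G_k$: $l_{ii}=\sum_{j=0}^na_{ij}$ and $l_{ij}=-a_{ij}$ for $i\ne j$ ($i,j\ge1$). For $k\in\Gamma_c$ let $0<\beta_k<\min\Re\lambda(L^{(k)})$, and put $\theta=\min_{k\in\Gamma_c}\beta_k$. **Gain.** Let $\mathcal P=\mathcal P^{T}$ be positive definite with $$\mathcal A\mathcal P+\mathcal P\mathcal A^{T}-2\mathcal P\mathcal C^{T}\begin{bmatrix}I_{p_1}&0\\0&\theta I_{p_2}\end{bmatrix}\mathcal C\mathcal P+I_{p\bar n}=0.$$ Put $S(\varepsilon)=\mathrm{diag}(I_p\varepsilon^{-1},\dots,I_p\varepsilon^{-\bar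 n})$. **Claim.** Let $\tau_d>0$, $\alpha\in(0,1)$ and $\kappa>0$ with $$\kappa\ \ge\ \frac{\alpha+4\max\{\theta,1\}\,\lambda_{\max}^2(\mathcal P)}{1-\alpha}.$$ Then there is $\varepsilon^*\in(0,1]$ such that the following holds for every $\varepsilon\in(0,\varepsilon^*]$. Let $\sigma:[t_0,\infty)\to\{1,\dots,\delta\}$ be any right-continuous, piecewise constant switching signal with dwell time $\tau_d$, i.e. constant on each $[t_\ell,t_{\ell+1})$, where $t_{\ell+1}-t_\ell\ge\tau_d$ for $\ell=0,1,\dots$ and $t_\ell\to\infty$. Suppose that for some $\bar t_0\ge t_0$ and all $t\ge\bar t_0$ the total time in $[\bar t_0,t)$ during which $\sigma\in\Gamma_c$ is at least $\kappa$ times the total time in $[\bar t_0,t)$ during which $\sigma\in\Gamma_d$. Then, for all inputs $u_i$, all trajectories of the agents and exosystems on $[t_0,\infty)$, and all solutions $\hat\chi_1,\dots,\hat\chi_n$ of the distributed observer $$\dot{\hat\chi}_i=(\mathcal A+\mathcal L_i)\hat\chi_i+\mathcal B_iu_i+S(\varepsilon)\mathcal P\mathcal C^{T}\left(\begin{bmatrix}y_{si}\\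 \sum_{j=0}^na_{ij}(t)(y_{di}-y_{dj})\end{bmatrix}-\begin{bmatrix}\mathcal C_1\hat\chi_i\\ \sum_{j=0}^na_{ij}(t)(\hat y_i-\hat y_j)\end{bmatrix}\right),$$ $i=1,\dots,n$, where $\hat y_0=0$, $\hat y_i=\mathcal C_2\hat\chi_i$ for $i\geq 1$, and $a_{ij}(t)$ are the weights of $\bar G_{\sigma(t)}$, one has $\lim_{t\to\infty}(\chi_i(t)-\hat\chi_i(t))=0$ for every $i=1,\dots,n$. -/

import Mathlib

open Filter Topology MeasureTheory Matrix

noncomputable section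

/-- A weighted leader-follower digraph on the nodes `0, 1, …, n`, where `0` is the leader.
The pair `(j, i)` is an edge (node `i` obtains information from node `j`) iff `0 < a i j`. -/
structure LeaderFollowerGraph (n : ℕ) where
  a : Matrix (Fin (n + 1)) (Fin (n + 1)) ℝ
  nonneg : ∀ i j, 0 ≤ a i j
  diag_zero : ∀ i, a i i = 0
  leader_zero : ∀ j, a 0 j = 0

namespace LeaderFollowerGraph

variable {n : ℕ}

/-- `(j, i)` is an edge. -/
def Edge (G : LeaderFollowerGraph n) (j i : Fin (n + 1)) : Prop := 0 < G.a i j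

/-- The graph contains a directed spanning tree rooted at the leader: the leader has a directed
path to every other node. -/
def HasLeaderTree (G : LeaderFollowerGraph n) : Prop :=
  ∀ i, Relation.ReflTransGen G.Edge 0 i

/-- The grounded Laplacian: `l i i = ∑_{j=0}^n a i j` and `l i j = - a i j` for `i ≠ j`, where
`i`, `j` range over the followers. -/
def laplacian (G : LeaderFollowerGraph n) : Matrix (Fin n) (Fin n) ℝ :=
  Matrix.of fun i j =>
    if i = j then ∑ k : Fin (n + 1), G.a i.succ k else - G.a i.succ j.succ

end LeaderFollowerGraph

/-- `σ` is piecewise constant and right continuous on `[t₀, ∞)`, with switching instants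
`t₀ = τ 0 < τ 1 < ⋯ → ∞` any two of which are at least the dwell time `τd` apart. -/
def HasDwellTime {Γ : Type} (σ : ℝ → Γ) (t₀ τd : ℝ) : Prop :=
  ∃ τ : ℕ → ℝ, τ 0 = t₀ ∧ (∀ l, τd ≤ τ (l + 1) - τ l) ∧ Tendsto τ atTop atTop ∧
    ∀ l, ∀ s ∈ Set.Ico (τ l) (τ (l + 1)), σ s = σ (τ l)

/-- Total time in `[s, t)` during which the value of `σ` lies in `K`. -/
def activationTime {Γ : Type} (σ : ℝ → Γ) (K : Set Γ) (s t : ℝ) : ℝ :=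
  (volume {r : ℝ | r ∈ Set.Ico s t ∧ σ r ∈ K}).toReal

/-- `x` solves `ẋ = f` on `[t₀, ∞)` in the sense of Carathéodory, where `f` is the right-hand side
evaluated along the trajectory. -/
def SolvesFrom {ι : Type} [Fintype ι] (t₀ : ℝ) (x f : ℝ → ι → ℝ) : Prop :=
  ∀ t, t₀ ≤ t → IntervalIntegrable f volume t₀ t ∧ x t = x t₀ + ∫ s in t₀..t, f s

/-- Observability of the pair `(A, C)`: the observability matrix with blocks
`C, C A, …, C A ^ (dim - 1)` has trivial kernel. -/
def IsObservable {ι κ : Type} [Fintype ι] [DecidableEq ι] [Fintype κ]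
    (A : Matrix ι ι ℝ) (C : Matrix κ ι ℝ) : Prop :=
  ∀ v : ι → ℝ, (∀ k < Fintype.card ι, (C * A ^ k) *ᵥ v = 0) → v = 0

/-- The largest eigenvalue of a real symmetric matrix. -/
def lambdaMax {ι : Type} [Fintype ι] [DecidableEq ι] (M : Matrix ι ι ℝ) : ℝ :=
  sSup (spectrum ℝ M)

/-- The data of `n` agents `ẋᵢ = Aᵢ xᵢ + Bᵢ uᵢ`, their individual exosystems `ω̇ᵢ = Sᵢ ωᵢ`, the
group exosystem `ẋ₀ = A₀ x₀`, and the outputs `y_{si} = C_{si} xᵢ + C_{wi} ωᵢ`,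
`y_{di} = C_{di} xᵢ`, `y_{d0} = C₀ x₀`. -/
structure AgentNetwork (n p₁ p₂ : ℕ) where
  /-- dimension of the state of each agent -/
  nx : Fin n → ℕ
  /-- dimension of the input of each agent -/
  nu : Fin n → ℕ
  /-- dimension of each individual exosystem -/
  nw : Fin n → ℕ
  /-- dimension of the group exosystem -/
  n₀ : ℕ
  A : ∀ i, Matrix (Fin (nx i)) (Fin (nx i)) ℝ
  B : ∀ i, Matrix (Fin (nx i)) (Fin (nu i)) ℝ
  S : ∀ i, Matrix (Fin (nw i)) (Fin (nw i)) ℝ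
  A₀ : Matrix (Fin n₀) (Fin n₀) ℝ
  Cs : ∀ i, Matrix (Fin p₁) (Fin (nx i)) ℝ
  Cw : ∀ i, Matrix (Fin p₁) (Fin (nw i)) ℝ
  Cd : ∀ i, Matrix (Fin p₂) (Fin (nx i)) ℝ
  C₀ : Matrix (Fin p₂) (Fin n₀) ℝ

namespace AgentNetwork

variable {n p₁ p₂ : ℕ} (N : AgentNetwork n p₁ p₂)

/-- The observability assumptions on the agents and the exosystems. -/
structure Observable : Prop where
  agent : ∀ i, IsObservable (N.A i) (fromRows (N.Cs i) (N.Cd i))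
  individual : ∀ i, IsObservable (N.S i) (N.Cw i)
  group : IsObservable N.A₀ N.C₀

/-- Index type of the compact state `(xᵢ, ωᵢ, x₀)`. -/
abbrev AugIdx (i : Fin n) : Type := Fin (N.nx i) ⊕ (Fin (N.nw i) ⊕ Fin N.n₀)

/-- State matrix `diag(Aᵢ, Sᵢ, A₀)` of the compact form. -/
def augA (i : Fin n) : Matrix (N.AugIdx i) (N.AugIdx i) ℝ :=
  fromBlocks (N.A i) 0 0 (fromBlocks (N.S i) 0 0 N.A₀)

/-- Input matrix of the compact form. -/
def augB (i : Fin n) : Matrix (N.AugIdx i) (Fin (N.nu i)) ℝ :=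
  fromRows (N.B i) 0

/-- Output matrix of the compact form; the output is `(y_{si}, y_{di} - y_{d0})`. -/
def augC (i : Fin n) : Matrix (Fin p₁ ⊕ Fin p₂) (N.AugIdx i) ℝ :=
  fromBlocks (N.Cs i) (fromCols (N.Cw i) 0) (N.Cd i) (fromCols 0 (-N.C₀))

/-- `n̄ = n₀ + max_i (n_i + q_i)`. -/
def nbar : ℕ := N.n₀ + Finset.univ.sup fun i => N.nx i + N.nw i

/-- The index type of `ℝ^{p n̄}`, as `n̄` blocks of size `p = p₁ + p₂`. -/
abbrev ChiIdx : Type := Fin N.nbar × (Fin p₁ ⊕ Fin p₂)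

/-- The transformation `x̄ᵢ = Wᵢ (xᵢ, ωᵢ, x₀)` that removes the redundant modes of each agent: `Wᵢ`
is onto, it annihilates exactly the modes that have no effect on `(y_{si}, y_{di} - y_{d0})`, and
in the new state the dynamics have the block form
`x̄ᵢ' = [Aᵢ Ā₁₂; 0 Ā₂₂] x̄ᵢ + [Bᵢ; 0] uᵢ`, `(y_{si}, y_{di} - y_{d0}) = [C_{si} ∗; C_{di} ∗] x̄ᵢ`. -/
structure Reduction where
  /-- dimension of the second component of the new state -/
  r : Fin n → ℕ
  W : ∀ i, Matrix (Fin (N.nx i) ⊕ Fin (r i)) (N.AugIdx i) ℝ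
  A₁₂ : ∀ i, Matrix (Fin (N.nx i)) (Fin (r i)) ℝ
  A₂₂ : ∀ i, Matrix (Fin (r i)) (Fin (r i)) ℝ
  C₂ : ∀ i, Matrix (Fin p₁ ⊕ Fin p₂) (Fin (r i)) ℝ
  onto : ∀ i, Function.Surjective fun z => W i *ᵥ z
  ker : ∀ i z, W i *ᵥ z = 0 ↔ ∀ k : ℕ, (N.augC i * N.augA i ^ k) *ᵥ z = 0
  state_eq : ∀ i, W i * N.augA i = fromBlocks (N.A i) (A₁₂ i) 0 (A₂₂ i) * W i
  input_eq : ∀ i, W i * N.augB i = fromRows (N.B i) 0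
  output_eq : ∀ i, N.augC i = fromCols (fromRows (N.Cs i) (N.Cd i)) (C₂ i) * W i

namespace Reduction

variable {N} (R : N.Reduction)

/-- Index type of `x̄ᵢ`. -/
abbrev Idx (i : Fin n) : Type := Fin (N.nx i) ⊕ Fin (R.r i)

/-- `Āᵢ`. -/
def Abar (i : Fin n) : Matrix (R.Idx i) (R.Idx i) ℝ :=
  fromBlocks (N.A i) (R.A₁₂ i) 0 (R.A₂₂ i)

/-- `B̄ᵢ`. -/
def Bbar (i : Fin n) : Matrix (R.Idx i) (Fin (N.nu i)) ℝ :=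
  fromRows (N.B i) 0

/-- `C̄ᵢ`. -/
def Cbar (i : Fin n) : Matrix (Fin p₁ ⊕ Fin p₂) (R.Idx i) ℝ :=
  fromCols (fromRows (N.Cs i) (N.Cd i)) (R.C₂ i)

/-- `Tᵢ = [C̄ᵢ; C̄ᵢ Āᵢ; …; C̄ᵢ Āᵢ ^ (n̄ - 1)]`. -/
def T (i : Fin n) : Matrix N.ChiIdx (R.Idx i) ℝ :=
  Matrix.of fun b c => (R.Cbar i * R.Abar i ^ (b.1 : ℕ)) b.2 c

/-- `ℬᵢ = Tᵢ B̄ᵢ`. -/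
def calB (i : Fin n) : Matrix N.ChiIdx (Fin (N.nu i)) ℝ := R.T i * R.Bbar i

/-- `χᵢ = Tᵢ x̄ᵢ = Tᵢ Wᵢ (xᵢ, ωᵢ, x₀)`. -/
def chi (i : Fin n) (x : Fin (N.nx i) → ℝ) (w : Fin (N.nw i) → ℝ) (x₀ : Fin N.n₀ → ℝ) :
    N.ChiIdx → ℝ :=
  R.T i *ᵥ (R.W i *ᵥ Sum.elim x (Sum.elim w x₀))

end Reduction

/-- The block shift `𝒜 = [0 I; 0 0]`. -/
def calA : Matrix N.ChiIdx N.ChiIdx ℝ :=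
  Matrix.of fun b c => if (c.1 : ℕ) = b.1 + 1 ∧ c.2 = b.2 then 1 else 0

/-- `𝒞 = [I 0]`. -/
def calC : Matrix (Fin p₁ ⊕ Fin p₂) N.ChiIdx ℝ :=
  Matrix.of fun j c => if (c.1 : ℕ) = 0 ∧ c.2 = j then 1 else 0

/-- `ℒ = [0; L]`, with `L` in the last block row. -/
def calL (L : Matrix (Fin p₁ ⊕ Fin p₂) N.ChiIdx ℝ) : Matrix N.ChiIdx N.ChiIdx ℝ :=
  Matrix.of fun b c => if (b.1 : ℕ) + 1 = N.nbar then L b.2 c else 0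

/-- `S(ε) = diag(I ε⁻¹, I ε⁻², …, I ε^{-n̄})`. -/
def gainS (ε : ℝ) : Matrix N.ChiIdx N.ChiIdx ℝ :=
  Matrix.diagonal fun b => (ε ^ ((b.1 : ℕ) + 1))⁻¹

/-- `diag(I_{p₁}, θ I_{p₂})`. -/
def weight (p₁ p₂ : ℕ) (θ : ℝ) : Matrix (Fin p₁ ⊕ Fin p₂) (Fin p₁ ⊕ Fin p₂) ℝ :=
  fromBlocks 1 0 0 (θ • 1)

/-- The algebraic Riccati equation for the observer gain `𝒫`. -/
def Riccati (θ : ℝ) (P : Matrix N.ChiIdx N.ChiIdx ℝ) : Prop :=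
  N.calA * P + P * N.calAᵀ - (2 : ℝ) • (P * N.calCᵀ * weight p₁ p₂ θ * N.calC * P) + 1 = 0

/-- The outputs `y_{d0}, y_{d1}, …, y_{dn}`. -/
def yd (x : ∀ i, Fin (N.nx i) → ℝ) (x₀ : Fin N.n₀ → ℝ) : Fin (n + 1) → Fin p₂ → ℝ :=
  Fin.cons (N.C₀ *ᵥ x₀) fun i => N.Cd i *ᵥ x i

/-- The estimates `ŷ₀ = 0` and `ŷᵢ = 𝒞₂ χ̂ᵢ`, where `𝒞₂` is the last `p₂` rows of `𝒞`. -/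
def yhat (z : Fin n → N.ChiIdx → ℝ) : Fin (n + 1) → Fin p₂ → ℝ :=
  Fin.cons 0 fun i => N.calC.submatrix Sum.inr id *ᵥ z i

/-- The neighbour-based sum `∑_{j=0}^n a_{ij} (yᵢ - yⱼ)` available to agent `i`. -/
def relSum (G : LeaderFollowerGraph n) (y : Fin (n + 1) → Fin p₂ → ℝ) (i : Fin n) : Fin p₂ → ℝ :=
  ∑ j : Fin (n + 1), G.a i.succ j • (y i.succ - y j)

/-- Right-hand side of the distributed high-gain observer of agent `i`, when the communication
graph is `G`, the states are `x`, `w`, `x₀`, the input of the agent is `u`, and the observer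
states of all agents are `z`. -/
def observerRHS (R : N.Reduction) (L : Fin n → Matrix (Fin p₁ ⊕ Fin p₂) N.ChiIdx ℝ)
    (P : Matrix N.ChiIdx N.ChiIdx ℝ) (ε : ℝ) (G : LeaderFollowerGraph n)
    (x : ∀ i, Fin (N.nx i) → ℝ) (w : ∀ i, Fin (N.nw i) → ℝ) (x₀ : Fin N.n₀ → ℝ)
    (i : Fin n) (u : Fin (N.nu i) → ℝ) (z : Fin n → N.ChiIdx → ℝ) : N.ChiIdx → ℝ :=
  (N.calA + N.calL (L i)) *ᵥ z i + R.calB i *ᵥ u +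
    (N.gainS ε * P * N.calCᵀ) *ᵥ
      (Sum.elim (N.Cs i *ᵥ x i + N.Cw i *ᵥ w i) (relSum G (N.yd x x₀) i) -
        Sum.elim (N.calC.submatrix Sum.inl id *ᵥ z i) (relSum G (N.yhat z) i))

end AgentNetwork

end

/-!
The estimation errors `eᵢ = χᵢ - χ̂ᵢ` obey a switched linear system: since `y_{di} - y_{dj}` is a
difference of the signals `𝒞₂ χᵢ` (with `𝒞₂ χ₀ = 0` for the leader), the innovations only involve
`𝒞₁ eᵢ` and `∑ⱼ lᵢⱼ 𝒞₂ eⱼ`. In the coordinates `S(ε)⁻¹ eᵢ` the stacked error solves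
`ξ' = K_σ ξ` with `K_k = ε⁻¹ (1 ⊗ 𝒜 - 1 ⊗ P D₁ - L⁽ᵏ⁾ ⊗ P D₂) + Y`, where `D₁ = 𝒞₁ᵀ𝒞₁`,
`D₂ = 𝒞₂ᵀ𝒞₂` and `Y` stays bounded as `ε → 0` (`AgentNetwork.errorMatrix_mulVec`, `AgentNetwork.abs_scaledL_le`).

For each graph take the Lyapunov function `ξᵀ (Q_k ⊗ P⁻¹) ξ`, where `Q_k` is positive definite with
`Q_k L⁽ᵏ⁾ + L⁽ᵏ⁾ᵀ Q_k ≥ 2 c Q_k`. Such a `Q_k` exists whenever all eigenvalues of `L⁽ᵏ⁾` have real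
part above `c` (`exists_posDef_lyapunov`): `c = θ` for `k ∈ Γc`, and `c = -1` for the other graphs,
as the spectrum of every grounded Laplacian lies in the closed right half plane by Gershgorin's
theorem. The Riccati equation turns the derivative of the Lyapunov function into
`ε⁻¹ (2 (θ - c) Q_k ⊗ D₂ - Q_k ⊗ P⁻²)` up to a nonpositive term and to `O(1)`
(`kronecker_lyapunov_identity`), so with `λ = λ_max(P)` it decays at rate `1 / (ε λ) - O(1)` for
`k ∈ Γc` and grows at rate at most `4 max(θ, 1) λ / ε + O(1)` otherwise. The condition on `κ` makes
the average decay rate at least `α / (ε λ) - O(1)`. Switching multiplies the Lyapunov function by at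
most a factor `μ` independent of `ε`, and happens at most once per time `τd`, so the decay wins as
soon as `α / (ε λ) - O(1) > log μ / τd`, that is, for all small `ε` (`tendsto_zero_of_switched`).
-/

open scoped Kronecker

/-! ### Lyapunov matrices from spectral bounds -/

open scoped Matrix.Norms.L2Operator in
/-- By Gelfand's formula. -/
theorem exists_norm_pow_lt_one {ι : Type} [Fintype ι] [DecidableEq ι] [Nonempty ι]
    (K : Matrix ι ι ℂ) (hK : ∀ ν ∈ spectrum ℂ K, ‖ν‖ < 1) : ∃ m : ℕ, 0 < m ∧ ‖K ^ m‖ < 1 := by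
  have hr : spectralRadius ℂ K < 1 := by
    obtain ⟨ν, hν, h⟩ := spectrum.exists_nnnorm_eq_spectralRadius K
    rw [← h]
    have := hK ν hν
    exact_mod_cast this
  have ht := spectrum.pow_nnnorm_pow_one_div_tendsto_nhds_spectralRadius K
  obtain ⟨m, h1, h2⟩ := ((ht.eventually_lt_const hr).and (eventually_gt_atTop 0)).exists
  refine ⟨m, h2, ?_⟩
  by_contra hcon
  push Not at hcon
  have h3 : (1 : ENNReal) ≤ (‖K ^ m‖₊ : ENNReal) := by exact_mod_cast hcon
  have := ENNReal.one_le_rpow h3 (z := 1 / (m : ℝ)) (by positivity)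
  exact absurd h1 (not_lt.mpr this)

open scoped Matrix.Norms.L2Operator in
/-- A bound on the operator norm of the complexification bounds the Euclidean norm of the real
matrix, here in squared form. -/
theorem norm_mulVec_sq_le_of_map_norm_lt_one {ι : Type} [Fintype ι] [DecidableEq ι]
    (A : Matrix ι ι ℝ) (hA : ‖A.map (algebraMap ℝ ℂ)‖ < 1) (v : ι → ℝ) :
    (A *ᵥ v) ⬝ᵥ (A *ᵥ v) ≤ v ⬝ᵥ v := by
  have key : ∀ u : ι → ℝ, u ⬝ᵥ u = ‖WithLp.toLp 2 (fun i => (u i : ℂ))‖ ^ 2 := by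
    intro u
    rw [EuclideanSpace.norm_sq_eq]
    simp [dotProduct, sq]
  have h1 := l2_opNorm_mulVec (A.map (algebraMap ℝ ℂ)) (WithLp.toLp 2 (fun i => (v i : ℂ)))
  have h2 : A.map (algebraMap ℝ ℂ) *ᵥ (fun i => (v i : ℂ)) = fun i => ((A *ᵥ v) i : ℂ) := by
    ext i
    simp [mulVec, dotProduct]
  have h3 : ‖WithLp.toLp 2 (fun i => ((A *ᵥ v) i : ℂ))‖ ≤
      ‖WithLp.toLp 2 (fun i => (v i : ℂ))‖ := by
    rw [← h2]
    exact h1.trans (mul_le_of_le_one_left (norm_nonneg _) hA.le)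
  rw [key, key]
  gcongr

/-- Lyapunov's theorem: if every eigenvalue of `M` has real part above `c`, then
`Q M + Mᵀ Q ≥ 2 c Q` for some positive definite `Q`. For small `h > 0` some power `K ^ m` of
`K = 1 - h (M - c)` is a contraction, and `Q = ∑_{j < m} (K ^ j)ᵀ K ^ j` satisfies `Kᵀ Q K ≤ Q`,
which is the claim up to the positive semidefinite term `h (M - c)ᵀ Q (M - c)`. -/
theorem exists_posDef_lyapunov {ι : Type} [Fintype ι] [DecidableEq ι] (M : Matrix ι ι ℝ) (c : ℝ)
    (hM : ∀ μ ∈ spectrum ℂ (M.map (algebraMap ℝ ℂ)), c < μ.re) :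
    ∃ Q : Matrix ι ι ℝ, Q.PosDef ∧ (Q * M + Mᵀ * Q - (2 * c) • Q).PosSemidef := by
  cases isEmpty_or_nonempty ι
  · refine ⟨1, PosDef.one, ?_⟩
    rw [Subsingleton.elim (1 * M + Mᵀ * 1 - (2 * c) • 1 : Matrix ι ι ℝ) 0]
    exact PosSemidef.zero
  -- a step `h` so small that `1 - h (M - c)` is a strict contraction in spectral radius
  obtain ⟨h, hh, hpos⟩ : ∃ h : ℝ, (∀ μ ∈ spectrum ℂ (M.map (algebraMap ℝ ℂ)),
      ‖1 - (h : ℂ) * (μ - c)‖ < 1) ∧ 0 < h := by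
    have hfin : (spectrum ℂ (M.map (algebraMap ℝ ℂ))).Finite := Matrix.finite_spectrum _
    have : ∀ᶠ h : ℝ in 𝓝[>] 0, ∀ μ ∈ spectrum ℂ (M.map (algebraMap ℝ ℂ)),
        ‖1 - (h : ℂ) * (μ - c)‖ < 1 := by
      rw [hfin.eventually_all]
      intro μ hμ
      have hre := hM μ hμ
      have hlim : Tendsto (fun h : ℝ => h * Complex.normSq (μ - c)) (𝓝[>] 0) (𝓝 0) := by
        have : Tendsto (fun h : ℝ => h * Complex.normSq (μ - c)) (𝓝 0)
            (𝓝 (0 * Complex.normSq (μ - c))) := tendsto_id.mul_const _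
        rw [zero_mul] at this
        exact this.mono_left nhdsWithin_le_nhds
      have h2 : 0 < 2 * (μ.re - c) := by linarith
      filter_upwards [hlim.eventually_lt_const h2, self_mem_nhdsWithin] with h h1 (h0 : 0 < h)
      rw [← sq_lt_one_iff₀ (norm_nonneg _), ← Complex.normSq_eq_norm_sq, Complex.normSq_apply]
      rw [Complex.normSq_apply] at h1
      simp only [Complex.sub_re, Complex.sub_im, Complex.one_re, Complex.one_im, Complex.mul_re,
        Complex.mul_im, Complex.ofReal_re, Complex.ofReal_im] at h1 ⊢
      have := mul_lt_mul_of_pos_left h1 h0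
      nlinarith
    obtain ⟨h, h1, h2⟩ := (this.and self_mem_nhdsWithin).exists
    exact ⟨h, h1, h2⟩
  set K : Matrix ι ι ℝ := 1 - h • (M - c • 1) with hKdef
  set Kc : Matrix ι ι ℂ := K.map (algebraMap ℝ ℂ) with hKc
  have hKc' : Kc = 1 - (h : ℂ) • (M.map (algebraMap ℝ ℂ) - (c : ℂ) • 1) := by
    ext i j
    by_cases hij : i = j <;> simp [hKc, hKdef, hij]
  have hspec : ∀ ν ∈ spectrum ℂ Kc, ‖ν‖ < 1 := by
    intro ν hν
    have hhc : (h : ℂ) ≠ 0 := by exact_mod_cast hpos.ne'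
    have hmem : (1 - ν) / h + c ∈ spectrum ℂ (M.map (algebraMap ℝ ℂ)) := by
      rw [spectrum.mem_iff] at hν ⊢
      intro hu
      apply hν
      have : algebraMap ℂ (Matrix ι ι ℂ) ν - Kc = (-(h : ℂ)) •
          (algebraMap ℂ (Matrix ι ι ℂ) ((1 - ν) / h + c) - M.map (algebraMap ℝ ℂ)) := by
        rw [hKc', Algebra.algebraMap_eq_smul_one, Algebra.algebraMap_eq_smul_one]
        have : (1 : Matrix ι ι ℂ) = ((h : ℂ) * (1 / h)) • 1 := by
          rw [mul_one_div_cancel hhc, one_smul]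
        ext i j
        simp only [Matrix.sub_apply, Matrix.smul_apply, smul_eq_mul]
        field_simp
        ring
      rw [this]
      exact hu.smul (Units.mk0 (-(h : ℂ)) (neg_ne_zero.mpr hhc))
    have := hh _ hmem
    rwa [add_sub_cancel_right, mul_div_cancel₀ _ hhc, sub_sub_cancel] at this
  obtain ⟨m, hm, hnorm⟩ := exists_norm_pow_lt_one Kc hspec
  -- in terms of quadratic forms, `K ^ m` is a contraction of the real Euclidean space
  have hcontr : (1 - (K ^ m)ᵀ * K ^ m).PosSemidef := by
    refine PosSemidef.of_dotProduct_mulVec_nonneg ?_ fun v => ?_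
    · simp [IsHermitian, conjTranspose_eq_transpose_of_trivial]
    · have hle := norm_mulVec_sq_le_of_map_norm_lt_one (K ^ m)
        (by rwa [Matrix.map_pow]) v
      rw [star_trivial, sub_mulVec, one_mulVec, dotProduct_sub, ← mulVec_mulVec,
        dotProduct_mulVec v, vecMul_transpose]
      linarith
  set Q : Matrix ι ι ℝ := ∑ j ∈ Finset.range m, (K ^ j)ᵀ * K ^ j with hQ
  -- the sum telescopes
  have hstein : Q - Kᵀ * Q * K = 1 - (K ^ m)ᵀ * K ^ m := by
    have h1 : Kᵀ * Q * K = ∑ j ∈ Finset.range m, (K ^ (j + 1))ᵀ * K ^ (j + 1) := by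
      rw [hQ, Finset.mul_sum, Finset.sum_mul]
      refine Finset.sum_congr rfl fun j _ => ?_
      rw [pow_succ, transpose_mul]
      simp only [Matrix.mul_assoc]
    have h2 := Finset.sum_range_succ (fun j => (K ^ j)ᵀ * K ^ j) m
    rw [Finset.sum_range_succ' (fun j => (K ^ j)ᵀ * K ^ j) m, ← h1, ← hQ] at h2
    simp only [pow_zero, transpose_one, Matrix.mul_one] at h2
    rw [sub_eq_sub_iff_add_eq_add, ← h2, add_comm]
  have hQpd : Q.PosDef := by
    obtain ⟨k, rfl⟩ := Nat.exists_eq_succ_of_ne_zero hm.ne'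
    rw [hQ, Finset.sum_range_succ']
    simp only [pow_zero, transpose_one, Matrix.mul_one]
    refine PosDef.posSemidef_add (posSemidef_sum _ fun j _ => ?_) PosDef.one
    rw [← conjTranspose_eq_transpose_of_trivial]
    exact posSemidef_conjTranspose_mul_self _
  refine ⟨Q, hQpd, ?_⟩
  have hkey : Q * M + Mᵀ * Q - (2 * c) • Q =
      h⁻¹ • (1 - (K ^ m)ᵀ * K ^ m) + h • ((M - c • 1)ᴴ * Q * (M - c • 1)) := by
    rw [← hstein, conjTranspose_eq_transpose_of_trivial]
    have e : Kᵀ * Q * K = Q - h • ((M - c • 1)ᵀ * Q + Q * (M - c • 1)) +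
        (h * h) • ((M - c • 1)ᵀ * Q * (M - c • 1)) := by
      rw [hKdef]
      generalize M - c • 1 = D
      rw [transpose_sub, transpose_smul, transpose_one]
      simp only [Matrix.sub_mul, Matrix.mul_sub, Matrix.one_mul, Matrix.mul_one,
        Matrix.smul_mul, Matrix.mul_smul, smul_sub, smul_add, smul_smul]
      abel
    rw [e, sub_add_eq_sub_sub, sub_sub_cancel, smul_sub, smul_smul, smul_smul,
      inv_mul_cancel₀ hpos.ne', inv_mul_cancel_left₀ hpos.ne', one_smul, sub_add_cancel,
      transpose_sub, transpose_smul, transpose_one, Matrix.sub_mul, Matrix.mul_sub,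
      Matrix.smul_mul, Matrix.mul_smul, Matrix.one_mul, Matrix.mul_one, two_mul, add_smul]
    abel
  rw [hkey]
  exact (hcontr.smul (inv_nonneg.mpr hpos.le)).add
    ((hQpd.posSemidef.conjTranspose_mul_mul_same _).smul hpos.le)

/-! ### Comparison of quadratic forms -/

theorem abs_dotProduct_mulVec_le {ι : Type} [Fintype ι] (Y : Matrix ι ι ℝ) (v : ι → ℝ) :
    |v ⬝ᵥ Y *ᵥ v| ≤ (∑ a, ∑ b, |Y a b|) * (v ⬝ᵥ v) := by
  have hv : ∀ a, v a ^ 2 ≤ v ⬝ᵥ v := fun a => by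
    rw [sq]
    exact Finset.single_le_sum (f := fun a => v a * v a) (fun i _ => mul_self_nonneg _)
      (Finset.mem_univ a)
  have h : ∀ a b, |v a * v b| ≤ v ⬝ᵥ v := fun a b => by
    rw [abs_le]
    constructor <;> nlinarith [hv a, hv b, sq_nonneg (v a + v b), sq_nonneg (v a - v b)]
  have e : v ⬝ᵥ Y *ᵥ v = ∑ a, ∑ b, Y a b * (v a * v b) := by
    simp only [dotProduct, mulVec, Finset.mul_sum, mul_left_comm]
  rw [e]
  simp only [Finset.sum_mul]
  refine (Finset.abs_sum_le_sum_abs _ _).trans (Finset.sum_le_sum fun a _ => ?_)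
  refine (Finset.abs_sum_le_sum_abs _ _).trans (Finset.sum_le_sum fun b _ => ?_)
  rw [abs_mul]
  exact mul_le_mul_of_nonneg_left (h a b) (abs_nonneg _)

/-- A positive definite form dominates a multiple of the Euclidean one. -/
theorem Matrix.PosDef.exists_mul_dotProduct_le {ι : Type} [Fintype ι] [DecidableEq ι]
    {X : Matrix ι ι ℝ} (hX : X.PosDef) :
    ∃ c : ℝ, 0 < c ∧ ∀ v : ι → ℝ, c * (v ⬝ᵥ v) ≤ v ⬝ᵥ X *ᵥ v := by
  have hB : 0 ≤ ∑ a, ∑ b, |X⁻¹ a b| :=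
    Finset.sum_nonneg fun a _ => Finset.sum_nonneg fun b _ => abs_nonneg _
  set B : ℝ := 1 + ∑ a, ∑ b, |X⁻¹ a b| with hBdef
  have hBpos : 0 < B := by linarith
  refine ⟨B⁻¹, inv_pos.mpr hBpos, fun v => ?_⟩
  -- expand the nonnegative number `(v - B⁻¹ X⁻¹ v)ᵀ X (v - B⁻¹ X⁻¹ v)`
  have h0 := hX.posSemidef.dotProduct_mulVec_nonneg (v - B⁻¹ • X⁻¹ *ᵥ v)
  have h1 := (le_abs_self _).trans (abs_dotProduct_mulVec_le X⁻¹ v)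
  have hXX : X *ᵥ (X⁻¹ *ᵥ v) = v := by
    rw [mulVec_mulVec, mul_nonsing_inv _ ((isUnit_iff_isUnit_det _).mp hX.isUnit), one_mulVec]
  have hsym : (X⁻¹ *ᵥ v) ⬝ᵥ X *ᵥ v = v ⬝ᵥ v := by
    have hT : Xᵀ = X := by
      rw [← conjTranspose_eq_transpose_of_trivial]; exact hX.isHermitian
    rw [dotProduct_mulVec, ← mulVec_transpose, hT, hXX]
  rw [star_trivial, mulVec_sub, mulVec_smul, hXX, sub_dotProduct, dotProduct_sub, dotProduct_sub,
    smul_dotProduct, smul_dotProduct, dotProduct_smul, dotProduct_smul, hsym,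
    dotProduct_comm (X⁻¹ *ᵥ v) v] at h0
  simp only [smul_eq_mul] at h0
  have hvv : 0 ≤ v ⬝ᵥ v := Finset.sum_nonneg fun i _ => mul_self_nonneg _
  have h2 : v ⬝ᵥ X⁻¹ *ᵥ v ≤ B * (v ⬝ᵥ v) := by nlinarith
  have h3 : B⁻¹ * (B⁻¹ * (v ⬝ᵥ X⁻¹ *ᵥ v)) ≤ B⁻¹ * (v ⬝ᵥ v) := by
    refine mul_le_mul_of_nonneg_left ?_ (inv_nonneg.mpr hBpos.le)
    rwa [inv_mul_le_iff₀ hBpos]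
  linarith

open scoped MatrixOrder in
theorem posSemidef_lambdaMax_smul_one_sub {κ : Type} [Fintype κ] [DecidableEq κ]
    {P : Matrix κ κ ℝ} (hP : P.IsHermitian) :
    (lambdaMax P • (1 : Matrix κ κ ℝ) - P).PosSemidef := by
  have hbdd : BddAbove (spectrum ℝ P) := (Matrix.finite_spectrum P).bddAbove
  have := le_algebraMap_of_spectrum_le (a := P) (r := lambdaMax P)
    (fun x hx => le_csSup hbdd hx)  hP
  rwa [Algebra.algebraMap_eq_smul_one] at this

theorem lambdaMax_pos {κ : Type} [Fintype κ] [DecidableEq κ] [Nonempty κ]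
    {P : Matrix κ κ ℝ} (hP : P.PosDef) : 0 < lambdaMax P :=
  (hP.eigenvalues_pos (Classical.arbitrary κ)).trans_le
    (le_csSup (Matrix.finite_spectrum P).bddAbove (hP.isHermitian.eigenvalues_mem_spectrum_real _))

/-- `lam P⁻² - P⁻¹` is positive semidefinite as soon as `P ≤ lam`. -/
theorem posSemidef_smul_inv_mul_inv_sub {κ : Type} [Fintype κ] [DecidableEq κ]
    {P : Matrix κ κ ℝ} (hP : P.PosDef) {lam : ℝ}
    (h : (lam • (1 : Matrix κ κ ℝ) - P).PosSemidef) :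
    (lam • (P⁻¹ * P⁻¹) - P⁻¹).PosSemidef := by
  have := h.conjTranspose_mul_mul_same P⁻¹
  rwa [hP.inv.isHermitian.eq, Matrix.mul_sub, Matrix.sub_mul, Matrix.mul_smul, Matrix.smul_mul,
    Matrix.mul_one, nonsing_inv_mul _ ((isUnit_iff_isUnit_det _).mp hP.isUnit), Matrix.one_mul]
    at this

/-- `lam P⁻¹ - 1` is positive semidefinite as soon as `P ≤ lam`. -/
theorem posSemidef_smul_inv_sub_one {κ : Type} [Fintype κ] [DecidableEq κ]
    {P : Matrix κ κ ℝ} (hP : P.PosDef) {lam : ℝ} (hlam : 0 < lam)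
    (h : (lam • (1 : Matrix κ κ ℝ) - P).PosSemidef) :
    (lam • P⁻¹ - 1).PosSemidef := by
  have hu := (isUnit_iff_isUnit_det _).mp hP.isUnit
  have h1 := hP.posSemidef.conjTranspose_mul_mul_same (lam • P⁻¹ - 1)
  have hH : (lam • P⁻¹ - 1)ᴴ = lam • P⁻¹ - 1 := by
    rw [conjTranspose_sub, conjTranspose_smul, hP.inv.isHermitian.eq, conjTranspose_one,
      star_trivial]
  have h2 : lam • P⁻¹ - 1 =
      lam⁻¹ • ((lam • P⁻¹ - 1)ᴴ * P * (lam • P⁻¹ - 1) + (lam • (1 : Matrix κ κ ℝ) - P)) := by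
    rw [hH]
    simp only [Matrix.sub_mul, Matrix.mul_sub, Matrix.one_mul, Matrix.mul_one, Matrix.smul_mul,
      Matrix.mul_smul, nonsing_inv_mul _ hu, mul_nonsing_inv _ hu, smul_sub, smul_add, smul_smul,
      inv_mul_cancel_left₀ hlam.ne', inv_mul_cancel₀ hlam.ne', one_smul]
    abel
  rw [h2]
  exact (h1.add h).smul (inv_nonneg.mpr hlam.le)

/-- Multiplying the Riccati equation by `P⁻¹` on both sides. -/
theorem riccati_inv {κ : Type} [Fintype κ] [DecidableEq κ] {P A D : Matrix κ κ ℝ}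
    (hu : IsUnit P.det) (h : A * P + P * Aᵀ - (2 : ℝ) • (P * D * P) + 1 = 0) :
    P⁻¹ * A + Aᵀ * P⁻¹ = (2 : ℝ) • D - P⁻¹ * P⁻¹ := by
  have h1 : P⁻¹ * (A * P + P * Aᵀ - (2 : ℝ) • (P * D * P) + 1) * P⁻¹ = 0 := by
    rw [h, Matrix.mul_zero, Matrix.zero_mul]
  simp only [Matrix.mul_add, Matrix.mul_sub, Matrix.add_mul, Matrix.sub_mul, Matrix.mul_smul,
    Matrix.smul_mul, Matrix.mul_assoc, mul_nonsing_inv _ hu, nonsing_inv_mul_cancel_left _ _ hu,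
    Matrix.mul_one] at h1
  rw [eq_sub_iff_add_eq, ← sub_eq_zero, ← h1]
  abel


/-- A perturbation `Y` with entrywise bound `Z` changes the derivative of `vᵀ X v` by at most a
multiple of `vᵀ X v` that depends only on `X` and `Z`. -/
theorem Matrix.PosDef.exists_perturbation_bound {ι : Type} [Fintype ι] [DecidableEq ι]
    {X : Matrix ι ι ℝ} (hX : X.PosDef) (Z : Matrix ι ι ℝ) :
    ∃ c : ℝ, 0 ≤ c ∧ ∀ Y : Matrix ι ι ℝ, (∀ a b, |Y a b| ≤ Z a b) → ∀ v : ι → ℝ,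
      v ⬝ᵥ (X * Y + Yᵀ * X) *ᵥ v ≤ c * (v ⬝ᵥ X *ᵥ v) := by
  obtain ⟨c, hc, hcX⟩ := hX.exists_mul_dotProduct_le
  set B : ℝ := ∑ a, ∑ b, ∑ d, |X a d| * |Z d b| with hB
  have hB0 : 0 ≤ B := by positivity
  refine ⟨2 * B / c, by positivity, fun Y hY v => ?_⟩
  have hT : Xᵀ = X := by
    rw [← conjTranspose_eq_transpose_of_trivial]; exact hX.isHermitian
  have hsym : v ⬝ᵥ (Yᵀ * X) *ᵥ v = v ⬝ᵥ (X * Y) *ᵥ v := by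
    rw [dotProduct_comm, ← vecMul_transpose, transpose_mul, transpose_transpose, hT,
      ← dotProduct_mulVec]
  have h1 : ∑ a, ∑ b, |(X * Y) a b| ≤ B := by
    refine Finset.sum_le_sum fun a _ => Finset.sum_le_sum fun b _ => ?_
    rw [Matrix.mul_apply]
    refine (Finset.abs_sum_le_sum_abs _ _).trans (Finset.sum_le_sum fun d _ => ?_)
    rw [abs_mul]
    exact mul_le_mul_of_nonneg_left ((hY d b).trans (le_abs_self _)) (abs_nonneg _)
  have hvv : 0 ≤ v ⬝ᵥ v := Finset.sum_nonneg fun i _ => mul_self_nonneg _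
  have h2 := (le_abs_self _).trans (abs_dotProduct_mulVec_le (X * Y) v)
  have h3 : v ⬝ᵥ (X * Y) *ᵥ v ≤ B * (v ⬝ᵥ v) := h2.trans (mul_le_mul_of_nonneg_right h1 hvv)
  rw [add_mulVec, dotProduct_add, hsym]
  calc v ⬝ᵥ (X * Y) *ᵥ v + v ⬝ᵥ (X * Y) *ᵥ v ≤ 2 * B / c * (c * (v ⬝ᵥ v)) := by
        rw [← mul_assoc, div_mul_cancel₀ _ hc.ne']; linarith
    _ ≤ _ := mul_le_mul_of_nonneg_left (hcX v) (by positivity)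

/-- Finitely many positive definite quadratic forms are equivalent. -/
theorem exists_uniform_comparison {Γ ι : Type} [Fintype Γ] [Fintype ι] [DecidableEq ι]
    (X : Γ → Matrix ι ι ℝ) (hX : ∀ k, (X k).PosDef) :
    ∃ μ : ℝ, 1 ≤ μ ∧ ∀ k l v, v ⬝ᵥ X k *ᵥ v ≤ μ * (v ⬝ᵥ X l *ᵥ v) := by
  choose c hc hcX using fun k => (hX k).exists_mul_dotProduct_le
  set B : Γ → ℝ := fun k => ∑ a, ∑ b, |X k a b| with hB
  have hB0 : ∀ k, 0 ≤ B k := fun k => by positivity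
  have hterm : ∀ k l, 0 ≤ B k / c l := fun k l => div_nonneg (hB0 k) (hc l).le
  have hsum : 0 ≤ ∑ k, ∑ l, B k / c l :=
    Finset.sum_nonneg fun k _ => Finset.sum_nonneg fun l _ => hterm k l
  refine ⟨1 + ∑ k, ∑ l, B k / c l, by linarith, fun k l v => ?_⟩
  have h1 : B k / c l ≤ 1 + ∑ k, ∑ l, B k / c l := by
    have h2 := Finset.single_le_sum (f := fun l => B k / c l) (fun l _ => hterm k l)
      (Finset.mem_univ l)
    have h3 := Finset.single_le_sum (f := fun k => ∑ l, B k / c l)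
      (fun k _ => Finset.sum_nonneg fun l _ => hterm k l) (Finset.mem_univ k)
    linarith
  have h0 : 0 ≤ v ⬝ᵥ X l *ᵥ v := by
    simpa using (hX l).posSemidef.dotProduct_mulVec_nonneg v
  calc v ⬝ᵥ X k *ᵥ v ≤ B k * (v ⬝ᵥ v) := (le_abs_self _).trans (abs_dotProduct_mulVec_le _ v)
    _ = B k / c l * (c l * (v ⬝ᵥ v)) := by rw [← mul_assoc, div_mul_cancel₀ _ (hc l).ne']
    _ ≤ B k / c l * (v ⬝ᵥ X l *ᵥ v) := mul_le_mul_of_nonneg_left (hcX l v) (hterm k l)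
    _ ≤ _ := mul_le_mul_of_nonneg_right h1 h0

/-! ### Kronecker products and the Riccati equation -/

theorem kronecker_sub_right {ι κ : Type} (Q : Matrix ι ι ℝ) (X Y : Matrix κ κ ℝ) :
    Q ⊗ₖ (X - Y) = Q ⊗ₖ X - Q ⊗ₖ Y := by
  ext
  simp [mul_sub]

theorem kronecker_sub_left {ι κ : Type} (Q R : Matrix ι ι ℝ) (X : Matrix κ κ ℝ) :
    (Q - R) ⊗ₖ X = Q ⊗ₖ X - R ⊗ₖ X := by
  ext
  simp [sub_mul]

/-- The matrix of the quadratic form `d/dt ξᵀ (Q ⊗ P⁻¹) ξ` along `ξ' = K ξ`. -/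
theorem kronecker_lyapunov_identity {ι κ : Type} [Fintype ι] [DecidableEq ι] [Fintype κ]
    [DecidableEq κ] {P A D₁ D₂ : Matrix κ κ ℝ} {Q M : Matrix ι ι ℝ} {θ : ℝ} (c ε : ℝ)
    (Y : Matrix (ι × κ) (ι × κ) ℝ) (hu : IsUnit P.det) (hP : Pᵀ = P)
    (hD₁ : D₁ᵀ = D₁) (hD₂ : D₂ᵀ = D₂)
    (h : A * P + P * Aᵀ - (2 : ℝ) • (P * (D₁ + θ • D₂) * P) + 1 = 0) :
    (Q ⊗ₖ P⁻¹) * (ε⁻¹ • ((1 : Matrix ι ι ℝ) ⊗ₖ A - (1 : Matrix ι ι ℝ) ⊗ₖ (P * D₁)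
        - M ⊗ₖ (P * D₂)) + Y) +
      (ε⁻¹ • ((1 : Matrix ι ι ℝ) ⊗ₖ A - (1 : Matrix ι ι ℝ) ⊗ₖ (P * D₁)
        - M ⊗ₖ (P * D₂)) + Y)ᵀ * (Q ⊗ₖ P⁻¹) =
    ε⁻¹ • ((2 * (θ - c)) • (Q ⊗ₖ D₂) - Q ⊗ₖ (P⁻¹ * P⁻¹)
        - (Q * M + Mᵀ * Q - (2 * c) • Q) ⊗ₖ D₂) +
      ((Q ⊗ₖ P⁻¹) * Y + Yᵀ * (Q ⊗ₖ P⁻¹)) := by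
  have h1 := riccati_inv hu h
  have h2 : Q ⊗ₖ (P⁻¹ * A) + Q ⊗ₖ (Aᵀ * P⁻¹) =
      (2 : ℝ) • (Q ⊗ₖ D₁) + (2 * θ) • (Q ⊗ₖ D₂) - Q ⊗ₖ (P⁻¹ * P⁻¹) := by
    rw [← kronecker_add, h1, kronecker_sub_right, kronecker_smul, kronecker_add, kronecker_smul,
      smul_add, smul_smul]
  have hPD : ∀ D : Matrix κ κ ℝ, Dᵀ = D → (P * D)ᵀ * P⁻¹ = D := fun D hD => by
    rw [transpose_mul, hP, hD, Matrix.mul_assoc, mul_nonsing_inv _ hu, Matrix.mul_one]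
  have e1 : (Q ⊗ₖ P⁻¹) * ((1 : Matrix ι ι ℝ) ⊗ₖ A - (1 : Matrix ι ι ℝ) ⊗ₖ (P * D₁)
        - M ⊗ₖ (P * D₂)) = Q ⊗ₖ (P⁻¹ * A) - Q ⊗ₖ D₁ - (Q * M) ⊗ₖ D₂ := by
    simp only [Matrix.mul_sub, ← mul_kronecker_mul, Matrix.mul_one,
      nonsing_inv_mul_cancel_left _ _ hu]
  have e2 : ((1 : Matrix ι ι ℝ) ⊗ₖ A - (1 : Matrix ι ι ℝ) ⊗ₖ (P * D₁)
        - M ⊗ₖ (P * D₂))ᵀ * (Q ⊗ₖ P⁻¹) = Q ⊗ₖ (Aᵀ * P⁻¹) - Q ⊗ₖ D₁ - (Mᵀ * Q) ⊗ₖ D₂ := by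
    simp only [transpose_sub, ← kroneckerMap_transpose, Matrix.sub_mul,
      ← mul_kronecker_mul, transpose_one, Matrix.one_mul, hPD _ hD₁, hPD _ hD₂]
  rw [transpose_add, transpose_smul, Matrix.mul_add, Matrix.add_mul, Matrix.mul_smul,
    Matrix.smul_mul, e1, e2]
  have e3 : Q ⊗ₖ (P⁻¹ * A) = (2 : ℝ) • (Q ⊗ₖ D₁) + (2 * θ) • (Q ⊗ₖ D₂) - Q ⊗ₖ (P⁻¹ * P⁻¹)
      - Q ⊗ₖ (Aᵀ * P⁻¹) := by rw [← h2]; abel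
  rw [e3, kronecker_sub_left, add_kronecker, smul_kronecker]
  module

/-- The case `c = θ` of `kronecker_lyapunov_identity`, with `R = Q M + Mᵀ Q - 2 θ Q`: apart from the
perturbation `Y`, the form `ξᵀ (Q ⊗ P⁻¹) ξ` decays at rate `1 / (ε lam)`. -/
theorem connected_rate {ι κ : Type} [Fintype ι] [DecidableEq ι] [Fintype κ]
    [DecidableEq κ] {P D₂ : Matrix κ κ ℝ} {Q R : Matrix ι ι ℝ} {ε lam : ℝ} (hε : 0 < ε)
    (hlam : 0 < lam) (hP : P.PosDef) (hPlam : (lam • (1 : Matrix κ κ ℝ) - P).PosSemidef)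
    (hQ : Q.PosDef) (hR : R.PosSemidef) (hD₂ : D₂.PosSemidef) (v : ι × κ → ℝ) :
    v ⬝ᵥ (ε⁻¹ • ((0 : ℝ) • (Q ⊗ₖ D₂) - Q ⊗ₖ (P⁻¹ * P⁻¹) - R ⊗ₖ D₂)) *ᵥ v ≤
      -(1 / (ε * lam)) * (v ⬝ᵥ (Q ⊗ₖ P⁻¹) *ᵥ v) := by
  have h1 := (hQ.posSemidef.kronecker (posSemidef_smul_inv_mul_inv_sub hP hPlam)
    ).dotProduct_mulVec_nonneg v
  have h2 := (hR.kronecker hD₂).dotProduct_mulVec_nonneg v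
  rw [kronecker_sub_right, kronecker_smul] at h1
  simp only [star_trivial, sub_mulVec, dotProduct_sub, smul_mulVec, dotProduct_smul, smul_eq_mul,
    zero_mul] at h1 h2 ⊢
  have h3 : -(1 / (ε * lam)) * (v ⬝ᵥ (Q ⊗ₖ P⁻¹) *ᵥ v) =
      ε⁻¹ * (-(lam⁻¹ * (v ⬝ᵥ (Q ⊗ₖ P⁻¹) *ᵥ v))) := by
    field_simp
  rw [h3]
  refine mul_le_mul_of_nonneg_left ?_ (inv_nonneg.mpr hε.le)
  have h4 : lam⁻¹ * (v ⬝ᵥ (Q ⊗ₖ P⁻¹) *ᵥ v) ≤ v ⬝ᵥ (Q ⊗ₖ (P⁻¹ * P⁻¹)) *ᵥ v := by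
    rw [inv_mul_le_iff₀ hlam]
    linarith
  linarith

/-- The case `g = 2 (θ - c) ≥ 0` of `kronecker_lyapunov_identity`, with `R = Q M + Mᵀ Q - 2 c Q`:
apart from the perturbation `Y`, the form `ξᵀ (Q ⊗ P⁻¹) ξ` grows at rate at most `g lam / ε`. -/
theorem disconnected_rate {ι κ : Type} [Fintype ι] [DecidableEq ι] [Fintype κ]
    [DecidableEq κ] {P D₂ : Matrix κ κ ℝ} {Q R : Matrix ι ι ℝ} {ε lam g : ℝ} (hε : 0 < ε)
    (hlam : 0 < lam) (hg : 0 ≤ g) (hP : P.PosDef)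
    (hPlam : (lam • (1 : Matrix κ κ ℝ) - P).PosSemidef)
    (hQ : Q.PosDef) (hR : R.PosSemidef) (hD₂ : D₂.PosSemidef)
    (hD₂' : (1 - D₂).PosSemidef) (v : ι × κ → ℝ) :
    v ⬝ᵥ (ε⁻¹ • (g • (Q ⊗ₖ D₂) - Q ⊗ₖ (P⁻¹ * P⁻¹) - R ⊗ₖ D₂)) *ᵥ v ≤
      g * lam / ε * (v ⬝ᵥ (Q ⊗ₖ P⁻¹) *ᵥ v) := by
  have h1 := (hQ.posSemidef.kronecker (posSemidef_smul_inv_sub_one hP hlam hPlam)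
    ).dotProduct_mulVec_nonneg v
  have h2 := (hR.kronecker hD₂).dotProduct_mulVec_nonneg v
  have h3 := (hQ.posSemidef.kronecker hD₂').dotProduct_mulVec_nonneg v
  have h4 : (P⁻¹ * P⁻¹).PosSemidef := by
    have := posSemidef_conjTranspose_mul_self P⁻¹
    rwa [hP.inv.isHermitian.eq] at this
  have h5 := (hQ.posSemidef.kronecker h4).dotProduct_mulVec_nonneg v
  rw [kronecker_sub_right, kronecker_smul] at h1
  rw [kronecker_sub_right] at h3
  simp only [star_trivial, sub_mulVec, dotProduct_sub, smul_mulVec, dotProduct_smul, smul_eq_mul]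
    at h1 h2 h3 h5 ⊢
  rw [div_mul_eq_mul_div, div_eq_inv_mul]
  refine mul_le_mul_of_nonneg_left ?_ (inv_nonneg.mpr hε.le)
  have h6 : v ⬝ᵥ (Q ⊗ₖ D₂) *ᵥ v ≤ lam * (v ⬝ᵥ (Q ⊗ₖ P⁻¹) *ᵥ v) := by linarith
  have h7 := mul_le_mul_of_nonneg_left h6 hg
  rw [← mul_assoc] at h7
  linarith

/-! ### Spectrum of the grounded Laplacian -/

/-- Gershgorin's theorem applies because the rows of a grounded Laplacian are diagonally dominant;
no connectivity is needed. -/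
theorem laplacian_spectrum_re_nonneg {n : ℕ} (G : LeaderFollowerGraph n) (μ : ℂ)
    (hμ : μ ∈ spectrum ℂ (G.laplacian.map (algebraMap ℝ ℂ))) : 0 ≤ μ.re := by
  rw [← Matrix.spectrum_toLin', ← Module.End.hasEigenvalue_iff_mem_spectrum] at hμ
  obtain ⟨k, hk⟩ := eigenvalue_mem_ball hμ
  rw [Metric.mem_closedBall, dist_eq_norm] at hk
  have h1 : ∑ j ∈ Finset.univ.erase k, ‖G.laplacian.map (algebraMap ℝ ℂ) k j‖ ≤
      G.laplacian k k := by
    have h2 : ∑ j ∈ Finset.univ.erase k, ‖G.laplacian.map (algebraMap ℝ ℂ) k j‖ =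
        ∑ j ∈ Finset.univ.erase k, G.a k.succ j.succ := by
      refine Finset.sum_congr rfl fun j hj => ?_
      have hne : k ≠ j := (Finset.ne_of_mem_erase hj).symm
      simp [LeaderFollowerGraph.laplacian, hne, abs_of_nonneg (G.nonneg _ _)]
    have h3 : G.laplacian k k = G.a k.succ 0 + ∑ j : Fin n, G.a k.succ j.succ := by
      simp [LeaderFollowerGraph.laplacian, Fin.sum_univ_succ]
    rw [h2, h3]
    have h4 := Finset.sum_le_sum_of_subset_of_nonneg (Finset.erase_subset k Finset.univ)
      (f := fun j : Fin n => G.a k.succ j.succ) (fun j _ _ => G.nonneg _ _)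
    linarith [G.nonneg k.succ 0]
  have h5 := (Complex.abs_re_le_norm _).trans hk
  rw [abs_le, Complex.sub_re] at h5
  have h6 : (G.laplacian.map (algebraMap ℝ ℂ) k k).re = G.laplacian k k := by simp
  linarith [h5.1]

/-! ### Carathéodory solutions and quadratic forms along them -/

/-- Solutions can be tested coordinate by coordinate. -/
theorem solvesFrom_iff {ι : Type} [Fintype ι] {t₀ : ℝ} {x f : ℝ → ι → ℝ} :
    SolvesFrom t₀ x f ↔ ∀ a t, t₀ ≤ t → IntervalIntegrable (fun s => f s a) volume t₀ t ∧
      x t a = x t₀ a + ∫ s in t₀..t, f s a := by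
  have hint : ∀ t, IntervalIntegrable f volume t₀ t ↔
      ∀ a, IntervalIntegrable (fun s => f s a) volume t₀ t := fun t => by
    simp only [IntervalIntegrable, IntegrableOn, integrable_pi_iff, forall_and]
  have heval : ∀ t, t₀ ≤ t → (∀ a, IntervalIntegrable (fun s => f s a) volume t₀ t) → ∀ a,
      (∫ s in t₀..t, f s) a = ∫ s in t₀..t, f s a := fun t ht h a => by
    rw [intervalIntegral.integral_of_le ht, intervalIntegral.integral_of_le ht]
    exact eval_integral (fun b => (intervalIntegrable_iff_integrableOn_Ioc_of_le ht).mp (h b)) a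
  constructor
  · intro h a t ht
    obtain ⟨h1, h2⟩ := h t ht
    have h3 := (hint t).mp h1
    refine ⟨h3 a, ?_⟩
    rw [← heval t ht h3]
    exact congrFun h2 a
  · intro h t ht
    have h3 := fun a => (h a t ht).1
    refine ⟨(hint t).mpr h3, funext fun a => ?_⟩
    rw [Pi.add_apply, heval t ht h3]
    exact (h a t ht).2

theorem SolvesFrom.mulVec {ι κ : Type} [Fintype ι] [Fintype κ] {t₀ : ℝ} {x f : ℝ → ι → ℝ}
    (h : SolvesFrom t₀ x f) (M : Matrix κ ι ℝ) :
    SolvesFrom t₀ (fun t => M *ᵥ x t) fun t => M *ᵥ f t := by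
  intro t ht
  obtain ⟨h1, h2⟩ := h t ht
  have e : ∀ v, M *ᵥ v = M.mulVecLin.toContinuousLinearMap v := fun v => rfl
  simp only [e]
  refine ⟨⟨ContinuousLinearMap.integrable_comp _ h1.1, ContinuousLinearMap.integrable_comp _ h1.2⟩,
    ?_⟩
  rw [ContinuousLinearMap.intervalIntegral_comp_comm _ h1, ← map_add, ← h2]

theorem SolvesFrom.sub {ι : Type} [Fintype ι] {t₀ : ℝ} {x f y g : ℝ → ι → ℝ}
    (hx : SolvesFrom t₀ x f) (hy : SolvesFrom t₀ y g) :
    SolvesFrom t₀ (fun t => x t - y t) fun t => f t - g t := by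
  intro t ht
  refine ⟨(hx t ht).1.sub (hy t ht).1, ?_⟩
  rw [intervalIntegral.integral_sub (hx t ht).1 (hy t ht).1]
  simp only
  rw [(hx t ht).2, (hy t ht).2]
  abel

theorem SolvesFrom.sumElim {ι κ : Type} [Fintype ι] [Fintype κ] {t₀ : ℝ} {x f : ℝ → ι → ℝ}
    {y g : ℝ → κ → ℝ} (hx : SolvesFrom t₀ x f) (hy : SolvesFrom t₀ y g) :
    SolvesFrom t₀ (fun t => Sum.elim (x t) (y t)) fun t => Sum.elim (f t) (g t) := by
  rw [solvesFrom_iff] at hx hy ⊢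
  rintro (a | a)
  · exact hx a
  · exact hy a

theorem SolvesFrom.continuousOn {ι : Type} [Fintype ι] {t₀ : ℝ} {x f : ℝ → ι → ℝ}
    (h : SolvesFrom t₀ x f) : ContinuousOn x (Set.Ici t₀) := by
  intro t ht
  have ht' : t₀ ≤ t := ht
  have h1 : ContinuousOn (fun s => x t₀ + ∫ r in t₀..s, f r) (Set.Icc t₀ (t + 1)) := by
    have := intervalIntegral.continuousOn_primitive_interval' (h (t + 1) (by linarith)).1
      (Set.left_mem_uIcc)
    rw [Set.uIcc_of_le (by linarith)] at this
    exact continuousOn_const.add this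
  have h2 : ContinuousOn x (Set.Icc t₀ (t + 1)) := h1.congr fun s hs => (h s hs.1).2
  refine (h2 t ⟨ht', by linarith⟩).mono_of_mem_nhdsWithin ?_
  rw [← Set.Ici_inter_Iic]
  exact inter_mem_nhdsWithin _ (Iic_mem_nhds (by linarith))

/-- A Carathéodory solution has a right derivative wherever its right-hand side is continuous from
the right. -/
theorem SolvesFrom.hasDerivWithinAt {ι : Type} [Fintype ι] {t₀ t : ℝ} {x f : ℝ → ι → ℝ}
    (h : SolvesFrom t₀ x f) (ht : t₀ ≤ t) (hf : ContinuousWithinAt f (Set.Ici t) t) :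
    HasDerivWithinAt x (f t) (Set.Ici t) t := by
  have hmeas : StronglyMeasurableAtFilter f (𝓝[>] t) := by
    refine ⟨Set.Ioc t₀ (t + 1), ?_, ?_⟩
    · exact mem_of_superset (Ioc_mem_nhdsGT (by linarith)) (Set.Ioc_subset_Ioc_left ht)
    · exact ((intervalIntegrable_iff_integrableOn_Ioc_of_le (by linarith)).mp
        (h (t + 1) (by linarith)).1).aestronglyMeasurable
  have h1 := (intervalIntegral.integral_hasDerivWithinAt_right (h t ht).1 hmeas
    (hf.mono Set.Ioi_subset_Ici_self) (s := Set.Ici t)).const_add (x t₀)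
  exact h1.congr (fun s hs => (h s (ht.trans hs)).2) (h t ht).2

theorem HasDerivWithinAt.quadForm {ι : Type} [Fintype ι] {X K : Matrix ι ι ℝ} {ξ : ℝ → ι → ℝ}
    {s : Set ℝ} {t : ℝ} (h : HasDerivWithinAt ξ (K *ᵥ ξ t) s t) :
    HasDerivWithinAt (fun t => ξ t ⬝ᵥ X *ᵥ ξ t) (ξ t ⬝ᵥ (X * K + Kᵀ * X) *ᵥ ξ t) s t := by
  have hpi := hasDerivWithinAt_pi.mp h
  have h1 : HasDerivWithinAt (fun t => ξ t ⬝ᵥ X *ᵥ ξ t)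
      (∑ a, ((K *ᵥ ξ t) a * (X *ᵥ ξ t) a + ξ t a * (X *ᵥ (K *ᵥ ξ t)) a)) s t := by
    refine HasDerivWithinAt.fun_sum fun a _ => (hpi a).mul ?_
    exact HasDerivWithinAt.fun_sum fun b _ => (hpi b).const_mul _
  convert h1 using 1
  rw [Finset.sum_add_distrib, add_mulVec, dotProduct_add, add_comm, ← mulVec_mulVec,
    ← mulVec_mulVec, dotProduct_mulVec _ Kᵀ, vecMul_transpose]
  rfl

/-- Growth of a quadratic form along a linear system on one interval without switching. -/
theorem quadForm_le_exp {ι : Type} [Fintype ι] {X K : Matrix ι ι ℝ} {ξ : ℝ → ι → ℝ} {p q r : ℝ}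
    (hcont : ContinuousOn ξ (Set.Icc p q))
    (hder : ∀ t ∈ Set.Ico p q, HasDerivWithinAt ξ (K *ᵥ ξ t) (Set.Ici t) t)
    (hr : ∀ v, v ⬝ᵥ (X * K + Kᵀ * X) *ᵥ v ≤ r * (v ⬝ᵥ X *ᵥ v)) :
    ∀ t ∈ Set.Icc p q, ξ t ⬝ᵥ X *ᵥ ξ t ≤ (ξ p ⬝ᵥ X *ᵥ ξ p) * Real.exp (r * (t - p)) := by
  intro t ht
  have hc : ContinuousOn (fun t => ξ t ⬝ᵥ X *ᵥ ξ t) (Set.Icc p q) :=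
    (show Continuous fun v : ι → ℝ => v ⬝ᵥ X *ᵥ v by fun_prop).comp_continuousOn hcont
  have := le_gronwallBound_of_liminf_deriv_right_le hc
    (fun s hs r' hr' => (hder s hs).quadForm.liminf_right_slope_le hr') le_rfl
    (K := r) (ε := 0) (fun s _ => by simpa using hr (ξ s)) t ht
  rwa [gronwallBound_ε0] at this

/-! ### Activation times -/

theorem activationTime_nonneg {Γ : Type} (σ : ℝ → Γ) (A : Set Γ) (s t : ℝ) :
    0 ≤ activationTime σ A s t := ENNReal.toReal_nonneg

theorem volume_activation_ne_top {Γ : Type} (σ : ℝ → Γ) (A : Set Γ) (s t : ℝ) :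
    volume {r : ℝ | r ∈ Set.Ico s t ∧ σ r ∈ A} ≠ ⊤ :=
  ((measure_mono fun _ h => h.1).trans_lt (measure_Ico_lt_top (a := s) (b := t))).ne

theorem activationTime_add {Γ : Type} (σ : ℝ → Γ) (A : Set Γ) {s t u : ℝ} (hst : s ≤ t)
    (htu : t ≤ u) :
    activationTime σ A s u = activationTime σ A s t + activationTime σ A t u := by
  unfold activationTime
  rw [← ENNReal.toReal_add (volume_activation_ne_top _ _ _ _) (volume_activation_ne_top _ _ _ _),
    ← measure_inter_add_sdiff _ (measurableSet_Ico (a := s) (b := t))]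
  congr 3
  · ext r
    simp only [Set.mem_inter_iff, Set.mem_ofPred_eq, Set.mem_Ico]
    constructor
    · rintro ⟨⟨_, h⟩, h'⟩; exact ⟨h', h⟩
    · rintro ⟨h', h⟩; exact ⟨⟨⟨h'.1, h'.2.trans_le htu⟩, h⟩, h'⟩
  · ext r
    simp only [Set.mem_sdiff, Set.mem_ofPred_eq, Set.mem_Ico, not_and, not_lt]
    constructor
    · rintro ⟨⟨h1, h⟩, h'⟩; exact ⟨⟨h' h1.1, h1.2⟩, h⟩
    · rintro ⟨h', h⟩; exact ⟨⟨⟨hst.trans h'.1, h'.2⟩, h⟩, fun _ => h'.1⟩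

theorem activationTime_of_const {Γ : Type} {σ : ℝ → Γ} {A : Set Γ} {s t : ℝ} {k : Γ}
    (hst : s ≤ t) (hσ : ∀ r ∈ Set.Ico s t, σ r = k) (hk : k ∈ A) :
    activationTime σ A s t = t - s := by
  have : {r : ℝ | r ∈ Set.Ico s t ∧ σ r ∈ A} = Set.Ico s t := by
    ext r
    exact ⟨fun h => h.1, fun h => ⟨h, by rw [hσ r h]; exact hk⟩⟩
  rw [activationTime, this, Real.volume_Ico, ENNReal.toReal_ofReal (by linarith)]

theorem activationTime_of_const_notMem {Γ : Type} {σ : ℝ → Γ} {A : Set Γ} {s t : ℝ} {k : Γ}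
    (hσ : ∀ r ∈ Set.Ico s t, σ r = k) (hk : k ∉ A) : activationTime σ A s t = 0 := by
  have : {r : ℝ | r ∈ Set.Ico s t ∧ σ r ∈ A} = ∅ := by
    ext r
    simp only [Set.mem_ofPred_eq, Set.mem_empty_iff_false, iff_false, not_and]
    intro h
    rwa [hσ r h]
  rw [activationTime, this, measure_empty, ENNReal.toReal_zero]

/-- No measurability of `σ` is needed: outer measure is subadditive. -/
theorem sub_le_activationTime_add_compl {Γ : Type} (σ : ℝ → Γ) (A : Set Γ) {s t : ℝ}
    (hst : s ≤ t) : t - s ≤ activationTime σ A s t + activationTime σ Aᶜ s t := by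
  unfold activationTime
  rw [← ENNReal.toReal_add (volume_activation_ne_top _ _ _ _) (volume_activation_ne_top _ _ _ _)]
  have h : Set.Ico s t ⊆ {r : ℝ | r ∈ Set.Ico s t ∧ σ r ∈ A} ∪
      {r : ℝ | r ∈ Set.Ico s t ∧ σ r ∈ Aᶜ} := fun r hr => by
    by_cases hA : σ r ∈ A
    · exact Or.inl ⟨hr, hA⟩
    · exact Or.inr ⟨hr, hA⟩
  have h1 := (measure_mono h).trans (measure_union_le (μ := volume) _ _)
  rw [Real.volume_Ico] at h1
  rw [← ENNReal.toReal_ofReal (show 0 ≤ t - s by linarith)]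
  exact ENNReal.toReal_mono
    (ENNReal.add_ne_top.mpr ⟨volume_activation_ne_top _ _ _ _, volume_activation_ne_top _ _ _ _⟩) h1

/-! ### Switched linear systems -/

/-- The bound for a switched system on the `l`-th interval: each of the `l` switches so far costs a
factor `μ`. -/
theorem quadForm_le_of_switched {Γ ι : Type} [Fintype ι]
    {X K : Γ → Matrix ι ι ℝ} {A : Set Γ} {a b μ t₀ : ℝ} (hμ : 1 ≤ μ)
    (hXμ : ∀ k l v, v ⬝ᵥ X k *ᵥ v ≤ μ * (v ⬝ᵥ X l *ᵥ v))
    (hA : ∀ k ∈ A, ∀ v, v ⬝ᵥ (X k * K k + (K k)ᵀ * X k) *ᵥ v ≤ -a * (v ⬝ᵥ X k *ᵥ v))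
    (hA' : ∀ k ∉ A, ∀ v, v ⬝ᵥ (X k * K k + (K k)ᵀ * X k) *ᵥ v ≤ b * (v ⬝ᵥ X k *ᵥ v))
    {σ : ℝ → Γ} {ξ : ℝ → ι → ℝ} (hξ : SolvesFrom t₀ ξ fun t => K (σ t) *ᵥ ξ t)
    {τ : ℕ → ℝ} (hτ₀ : τ 0 = t₀) (hτ : Monotone τ)
    (hσ : ∀ l, ∀ s ∈ Set.Ico (τ l) (τ (l + 1)), σ s = σ (τ l)) (l : ℕ) :
    ∀ t ∈ Set.Icc (τ l) (τ (l + 1)), ξ t ⬝ᵥ X (σ (τ l)) *ᵥ ξ t ≤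
      (ξ t₀ ⬝ᵥ X (σ t₀) *ᵥ ξ t₀) * μ ^ l *
        Real.exp (-a * activationTime σ A t₀ t + b * activationTime σ Aᶜ t₀ t) := by
  have hstep : ∀ l, ∀ t ∈ Set.Icc (τ l) (τ (l + 1)), ξ t ⬝ᵥ X (σ (τ l)) *ᵥ ξ t ≤
      (ξ (τ l) ⬝ᵥ X (σ (τ l)) *ᵥ ξ (τ l)) *
        Real.exp (-a * activationTime σ A (τ l) t + b * activationTime σ Aᶜ (τ l) t) := by
    intro l t ht
    have ht₀ : t₀ ≤ τ l := hτ₀ ▸ hτ (Nat.zero_le l)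
    have hcont : ContinuousOn ξ (Set.Icc (τ l) (τ (l + 1))) :=
      hξ.continuousOn.mono fun s hs => ht₀.trans hs.1
    have hder : ∀ s ∈ Set.Ico (τ l) (τ (l + 1)),
        HasDerivWithinAt ξ (K (σ (τ l)) *ᵥ ξ s) (Set.Ici s) s := by
      intro s hs
      rw [← hσ l s hs]
      refine hξ.hasDerivWithinAt (ht₀.trans hs.1) ?_
      have h1 : ContinuousWithinAt (fun r => K (σ s) *ᵥ ξ r) (Set.Ici s) s :=
        (show Continuous fun v : ι → ℝ => K (σ s) *ᵥ v by fun_prop).continuousAt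
          |>.comp_continuousWithinAt
          ((hξ.continuousOn s (ht₀.trans hs.1)).mono (Set.Ici_subset_Ici.mpr (ht₀.trans hs.1)))
      refine h1.congr_of_eventuallyEq ?_ rfl
      filter_upwards [Ico_mem_nhdsGE hs.2] with r hr
      rw [hσ l s hs, hσ l r ⟨hs.1.trans hr.1, hr.2⟩]
    have hσt : ∀ r ∈ Set.Ico (τ l) t, σ r = σ (τ l) := fun r hr =>
      hσ l r ⟨hr.1, hr.2.trans_le ht.2⟩
    by_cases hk : σ (τ l) ∈ A
    · rw [activationTime_of_const ht.1 hσt hk,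
        activationTime_of_const_notMem (A := Aᶜ) hσt (fun h => h hk), mul_zero, add_zero]
      exact quadForm_le_exp hcont hder (hA _ hk) t ht
    · rw [activationTime_of_const_notMem hσt hk, activationTime_of_const (A := Aᶜ) ht.1 hσt hk,
        mul_zero, zero_add]
      exact quadForm_le_exp hcont hder (hA' _ hk) t ht
  induction l with
  | zero =>
    intro t ht
    have := hstep 0 t ht
    rw [hτ₀] at this ⊢
    simpa using this
  | succ l ih =>
    intro t ht
    have hl := hτ (Nat.le_succ l)
    have ht₀ : t₀ ≤ τ (l + 1) := hτ₀ ▸ hτ (Nat.zero_le _)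
    refine (hstep (l + 1) t ht).trans ?_
    rw [activationTime_add σ A ht₀ ht.1, activationTime_add σ Aᶜ ht₀ ht.1]
    have h1 := (hXμ (σ (τ (l + 1))) (σ (τ l)) (ξ (τ (l + 1)))).trans
      (mul_le_mul_of_nonneg_left (ih _ ⟨hl, le_rfl⟩) (by linarith))
    refine (mul_le_mul_of_nonneg_right h1 (Real.exp_pos _).le).trans (le_of_eq ?_)
    rw [mul_assoc μ, mul_assoc (_ * μ ^ l), ← Real.exp_add, pow_succ]
    ring_nf

/-- A switched linear system `ξ' = K (σ t) ξ` with multiple Lyapunov functions `vᵀ X k v` which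
decay at rate `a` for `k ∈ A`, grow at rate at most `b` for `k ∉ A`, and are comparable up to the
factor `μ`, converges to zero if `A` is active often enough and the average decay rate `ρ` exceeds
the growth `log μ / τd` caused by switching. -/
theorem tendsto_zero_of_switched {Γ ι : Type} [Fintype ι] [DecidableEq ι]
    {X K : Γ → Matrix ι ι ℝ} {A : Set Γ} {a b μ ρ κ τd t₀ : ℝ} (hX : ∀ k, (X k).PosDef)
    (hμ : 1 ≤ μ) (hXμ : ∀ k l v, v ⬝ᵥ X k *ᵥ v ≤ μ * (v ⬝ᵥ X l *ᵥ v))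
    (hA : ∀ k ∈ A, ∀ v, v ⬝ᵥ (X k * K k + (K k)ᵀ * X k) *ᵥ v ≤ -a * (v ⬝ᵥ X k *ᵥ v))
    (hA' : ∀ k ∉ A, ∀ v, v ⬝ᵥ (X k * K k + (K k)ᵀ * X k) *ᵥ v ≤ b * (v ⬝ᵥ X k *ᵥ v))
    (hτd : 0 < τd) (hρ : Real.log μ / τd < ρ) (hρa : ρ ≤ a) (hκ : b + ρ ≤ (a - ρ) * κ)
    {σ : ℝ → Γ} (hσ : HasDwellTime σ t₀ τd)
    (hratio : ∃ s, t₀ ≤ s ∧ ∀ t, s ≤ t →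
      κ * activationTime σ Aᶜ s t ≤ activationTime σ A s t)
    {ξ : ℝ → ι → ℝ} (hξ : SolvesFrom t₀ ξ fun t => K (σ t) *ᵥ ξ t) :
    Tendsto ξ atTop (𝓝 0) := by
  obtain ⟨τ, hτ₀, hgap, hlim, hconst⟩ := hσ
  obtain ⟨s, hs, hratio⟩ := hratio
  have hmono : Monotone τ := monotone_nat_of_le_succ fun l => by linarith [hgap l]
  have hlog : 0 ≤ Real.log μ := Real.log_nonneg hμ
  have hρ0 : 0 ≤ ρ := (div_nonneg hlog hτd.le).trans hρ.le
  have hlτ : ∀ l : ℕ, (l : ℝ) * τd ≤ τ l - t₀ := by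
    intro l
    induction l with
    | zero => simp [hτ₀]
    | succ l ih => push_cast; linarith [hgap l]
  set V₀ : ℝ := ξ t₀ ⬝ᵥ X (σ t₀) *ᵥ ξ t₀ with hV₀
  have hV₀0 : 0 ≤ V₀ := by simpa using (hX (σ t₀)).posSemidef.dotProduct_mulVec_nonneg (ξ t₀)
  set γ : ℝ := ρ - Real.log μ / τd with hγ
  have hγ0 : 0 < γ := sub_pos.mpr hρ
  set E : ℝ := -a * activationTime σ A t₀ s + b * activationTime σ Aᶜ t₀ s with hE
  have hbound : ∀ t, s ≤ t → ξ t ⬝ᵥ X (σ t₀) *ᵥ ξ t ≤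
      μ * V₀ * Real.exp (E + (s - t₀) * (Real.log μ / τd) + -(γ * (t - s))) := by
    intro t ht
    obtain ⟨l, hl⟩ : ∃ l, t ∈ Set.Ico (τ l) (τ (l + 1)) := by
      classical
      have hex : ∃ l, t < τ l := (hlim.eventually_gt_atTop t).exists
      have hne : Nat.find hex ≠ 0 := fun h0 => by
        have := Nat.find_spec hex
        rw [h0, hτ₀] at this
        linarith
      obtain ⟨l, hl⟩ := Nat.exists_eq_succ_of_ne_zero hne
      refine ⟨l, ?_, ?_⟩
      · exact not_lt.mp (Nat.find_min hex (by omega))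
      · have := Nat.find_spec hex
        rwa [hl] at this
    have h1 := quadForm_le_of_switched hμ hXμ hA hA' hξ hτ₀ hmono hconst l t ⟨hl.1, hl.2.le⟩
    -- the dwell time bounds the number `l` of switches up to time `t` by `(t - t₀) / τd`
    have h2 : μ ^ l ≤ Real.exp ((t - t₀) * (Real.log μ / τd)) := by
      rw [← Real.exp_log (show 0 < μ by linarith), ← Real.exp_nat_mul, Real.exp_log (by linarith)]
      refine Real.exp_le_exp.mpr ?_
      rw [mul_div_assoc', le_div_iff₀ hτd]
      have hlt : τ l - t₀ ≤ t - t₀ := by linarith [hl.1]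
      have := mul_le_mul_of_nonneg_right ((hlτ l).trans hlt) hlog
      linarith
    -- from `s` on, the ratio of the activation times turns the two rates into the average rate `ρ`
    have h3 : -a * activationTime σ A t₀ t + b * activationTime σ Aᶜ t₀ t ≤ E - ρ * (t - s) := by
      rw [activationTime_add σ A hs ht, activationTime_add σ Aᶜ hs ht]
      have h4 := mul_le_mul_of_nonneg_left (hratio t ht) (sub_nonneg.mpr hρa)
      have h5 := mul_le_mul_of_nonneg_right hκ (activationTime_nonneg σ Aᶜ s t)
      have h6 := mul_le_mul_of_nonneg_left (sub_le_activationTime_add_compl σ A ht) hρ0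
      rw [hE]
      linarith
    calc ξ t ⬝ᵥ X (σ t₀) *ᵥ ξ t ≤ μ * (ξ t ⬝ᵥ X (σ (τ l)) *ᵥ ξ t) := hXμ _ _ _
      _ ≤ μ * (V₀ * Real.exp ((t - t₀) * (Real.log μ / τd)) * Real.exp (E - ρ * (t - s))) := by
          refine mul_le_mul_of_nonneg_left (h1.trans ?_) (by linarith)
          exact mul_le_mul (mul_le_mul_of_nonneg_left h2 hV₀0) (Real.exp_le_exp.mpr h3)
            (Real.exp_pos _).le (by positivity)
      _ = _ := by
          rw [mul_assoc V₀, ← Real.exp_add, ← mul_assoc]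
          congr 2
          rw [hγ]
          ring
  have hexp : Tendsto (fun t => μ * V₀ *
      Real.exp (E + (s - t₀) * (Real.log μ / τd) + -(γ * (t - s)))) atTop (𝓝 0) := by
    rw [← mul_zero (μ * V₀)]
    refine (Real.tendsto_exp_atBot.comp (tendsto_atBot_add_const_left _ _ ?_)).const_mul _
    refine tendsto_neg_atTop_atBot.comp (Tendsto.const_mul_atTop hγ0 ?_)
    exact tendsto_atTop_add_const_right _ _ tendsto_id
  obtain ⟨c, hc, hcX⟩ := (hX (σ t₀)).exists_mul_dotProduct_le
  rw [tendsto_pi_nhds]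
  intro i
  have hsq : Tendsto (fun t => ξ t i ^ 2) atTop (𝓝 0) := by
    have h0 := hexp.const_mul c⁻¹
    rw [mul_zero] at h0
    refine tendsto_of_tendsto_of_tendsto_of_le_of_le' tendsto_const_nhds h0
      (Eventually.of_forall fun t => sq_nonneg _) ?_
    filter_upwards [eventually_ge_atTop s] with t ht
    rw [← div_eq_inv_mul, le_div_iff₀' hc]
    refine le_trans (mul_le_mul_of_nonneg_left ?_ hc.le) ((hcX (ξ t)).trans (hbound t ht))
    rw [sq]
    exact Finset.single_le_sum (f := fun a => ξ t a * ξ t a) (fun i _ => mul_self_nonneg _)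
      (Finset.mem_univ i)
  have := hsq.sqrt
  simp only [Real.sqrt_sq_eq_abs, Real.sqrt_zero] at this
  exact (tendsto_zero_iff_abs_tendsto_zero _).mpr this

/-! ### The error dynamics of the observer -/

namespace AgentNetwork

variable {n p₁ p₂ : ℕ} {N : AgentNetwork n p₁ p₂}

theorem augA_mulVec_add (i : Fin n) (x : Fin (N.nx i) → ℝ) (w : Fin (N.nw i) → ℝ)
    (x₀ : Fin N.n₀ → ℝ) (u : Fin (N.nu i) → ℝ) :
    N.augA i *ᵥ Sum.elim x (Sum.elim w x₀) + N.augB i *ᵥ u =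
      Sum.elim (N.A i *ᵥ x + N.B i *ᵥ u) (Sum.elim (N.S i *ᵥ w) (N.A₀ *ᵥ x₀)) := by
  rw [augA, augB, fromBlocks_mulVec, fromRows_mulVec, Sum.elim_comp_inl, Sum.elim_comp_inr,
    fromBlocks_mulVec, Sum.elim_comp_inl, Sum.elim_comp_inr]
  ext (a | a | a) <;> simp

theorem augC_mulVec (i : Fin n) (x : Fin (N.nx i) → ℝ) (w : Fin (N.nw i) → ℝ)
    (x₀ : Fin N.n₀ → ℝ) :
    N.augC i *ᵥ Sum.elim x (Sum.elim w x₀) =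
      Sum.elim (N.Cs i *ᵥ x + N.Cw i *ᵥ w) (N.Cd i *ᵥ x - N.C₀ *ᵥ x₀) := by
  rw [augC, fromBlocks_mulVec, Sum.elim_comp_inl, Sum.elim_comp_inr,
    fromCols_mulVec_sumElim, fromCols_mulVec_sumElim]
  simp [neg_mulVec, sub_eq_add_neg]

/-- The right-hand side of `χᵢ' = (𝒜 + ℒᵢ) χᵢ + ℬᵢ uᵢ`. -/
theorem Reduction.chi_dynamics (R : N.Reduction)
    {L : Fin n → Matrix (Fin p₁ ⊕ Fin p₂) N.ChiIdx ℝ}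
    (hL : ∀ i, R.T i * R.Abar i = (N.calA + N.calL (L i)) * R.T i) (i : Fin n)
    (x : Fin (N.nx i) → ℝ) (w : Fin (N.nw i) → ℝ) (x₀ : Fin N.n₀ → ℝ) (u : Fin (N.nu i) → ℝ) :
    R.chi i (N.A i *ᵥ x + N.B i *ᵥ u) (N.S i *ᵥ w) (N.A₀ *ᵥ x₀) =
      (N.calA + N.calL (L i)) *ᵥ R.chi i x w x₀ + R.calB i *ᵥ u := by
  unfold Reduction.chi Reduction.calB
  rw [← augA_mulVec_add, mulVec_add, mulVec_mulVec, mulVec_mulVec, R.state_eq, R.input_eq,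
    mulVec_add, ← mulVec_mulVec, ← mulVec_mulVec, mulVec_mulVec]
  congr 1
  rw [mulVec_mulVec _ (N.calA + _), ← hL]
  rfl

theorem calC_mulVec_apply (h : 0 < N.nbar) (z : N.ChiIdx → ℝ) (j : Fin p₁ ⊕ Fin p₂) :
    (N.calC *ᵥ z) j = z (⟨0, h⟩, j) := by
  rw [mulVec, dotProduct, Finset.sum_eq_single (⟨0, h⟩, j)]
  · simp [calC]
  · rintro ⟨c, k⟩ - hne
    have : ¬((c : ℕ) = 0 ∧ k = j) := fun ⟨h1, h2⟩ => hne (by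
      subst h2
      congr
      exact Fin.ext h1)
    simp [calC, this]
  · simp

/-- The first block of `χᵢ` is the output `(y_{si}, y_{di} - y_{d0})`. -/
theorem calC_mulVec_chi (R : N.Reduction) (h : 0 < N.nbar) (i : Fin n) (x : Fin (N.nx i) → ℝ)
    (w : Fin (N.nw i) → ℝ) (x₀ : Fin N.n₀ → ℝ) :
    N.calC *ᵥ R.chi i x w x₀ =
      Sum.elim (N.Cs i *ᵥ x + N.Cw i *ᵥ w) (N.Cd i *ᵥ x - N.C₀ *ᵥ x₀) := by
  rw [← augC_mulVec, R.output_eq, ← mulVec_mulVec]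
  ext j
  rw [calC_mulVec_apply h, Reduction.chi]
  simp [mulVec, Reduction.T, Reduction.Cbar, dotProduct]

/-- The neighbour-based sums only depend on the differences to the leader, through the grounded
Laplacian. -/
theorem relSum_eq (G : LeaderFollowerGraph n) (y : Fin (n + 1) → Fin p₂ → ℝ) (i : Fin n) :
    relSum G y i = ∑ j : Fin n, G.laplacian i j • (y j.succ - y 0) := by
  have h1 : ∀ j, G.laplacian i j • (y j.succ - y 0) =
      (if i = j then (∑ k, G.a i.succ k) • (y i.succ - y 0) else 0) -
        G.a i.succ j.succ • (y j.succ - y 0) := by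
    intro j
    by_cases hij : i = j
    · subst hij
      simp [LeaderFollowerGraph.laplacian, G.diag_zero]
    · simp [LeaderFollowerGraph.laplacian, hij]
  rw [Finset.sum_congr rfl fun j _ => h1 j, Finset.sum_sub_distrib, Finset.sum_ite_eq]
  simp only [Finset.mem_univ, if_true, relSum]
  have h2 : ∑ j : Fin n, G.a i.succ j.succ • (y j.succ - y 0) =
      ∑ j : Fin (n + 1), G.a i.succ j • (y j - y 0) := by
    rw [Fin.sum_univ_succ]
    simp
  rw [h2, Finset.sum_smul, ← Finset.sum_sub_distrib]
  refine Finset.sum_congr rfl fun j _ => ?_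
  rw [← smul_sub, sub_sub_sub_cancel_right]

/-- `diag(I_{p₁}, 0)`. -/
def selS (p₁ p₂ : ℕ) : Matrix (Fin p₁ ⊕ Fin p₂) (Fin p₁ ⊕ Fin p₂) ℝ := fromBlocks 1 0 0 0

/-- `diag(0, I_{p₂})`. -/
def selD (p₁ p₂ : ℕ) : Matrix (Fin p₁ ⊕ Fin p₂) (Fin p₁ ⊕ Fin p₂) ℝ := fromBlocks 0 0 0 1

variable (N) in
/-- `𝒞ᵀ diag(I_{p₁}, 0) 𝒞`. -/
def outerS : Matrix N.ChiIdx N.ChiIdx ℝ := N.calCᵀ * selS p₁ p₂ * N.calC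

variable (N) in
/-- `𝒞ᵀ diag(0, I_{p₂}) 𝒞`. -/
def outerD : Matrix N.ChiIdx N.ChiIdx ℝ := N.calCᵀ * selD p₁ p₂ * N.calC

theorem calC_weight (θ : ℝ) :
    N.calCᵀ * weight p₁ p₂ θ * N.calC = N.outerS + θ • N.outerD := by
  have : weight p₁ p₂ θ = selS p₁ p₂ + θ • selD p₁ p₂ := by
    rw [weight, selS, selD, fromBlocks_smul, fromBlocks_add]
    simp
  rw [this, Matrix.mul_add, Matrix.add_mul, Matrix.mul_smul, Matrix.smul_mul, outerS, outerD]

theorem outerS_transpose : N.outerSᵀ = N.outerS := by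
  rw [outerS, transpose_mul, transpose_mul, transpose_transpose, Matrix.mul_assoc, selS,
    fromBlocks_transpose]
  simp

theorem outerD_posSemidef : N.outerD.PosSemidef := by
  have h : (selD p₁ p₂).PosSemidef := by
    have := posSemidef_conjTranspose_mul_self (selD p₁ p₂)
    simpa [selD, fromBlocks_transpose, fromBlocks_multiply] using this
  exact h.conjTranspose_mul_mul_same N.calC

theorem outerD_transpose : N.outerDᵀ = N.outerD := by
  rw [← conjTranspose_eq_transpose_of_trivial]
  exact outerD_posSemidef.isHermitian

theorem one_sub_outerD_posSemidef (h : 0 < N.nbar) :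
    ((1 : Matrix N.ChiIdx N.ChiIdx ℝ) - N.outerD).PosSemidef := by
  refine PosSemidef.of_dotProduct_mulVec_nonneg
    (isHermitian_one.sub outerD_posSemidef.isHermitian) fun v => ?_
  have h1 : v ⬝ᵥ N.outerD *ᵥ v = ∑ j, v (⟨0, h⟩, Sum.inr j) * v (⟨0, h⟩, Sum.inr j) := by
    rw [outerD, Matrix.mul_assoc, ← mulVec_mulVec, dotProduct_mulVec, vecMul_transpose,
      ← mulVec_mulVec, dotProduct, Fintype.sum_sum_type]
    simp [-mulVec_mulVec, selD, fromBlocks_mulVec, calC_mulVec_apply h]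
  have h2 : ∑ j, v (⟨0, h⟩, Sum.inr j) * v (⟨0, h⟩, Sum.inr j) ≤ v ⬝ᵥ v := by
    have hinj : Function.Injective fun j : Fin p₂ => ((⟨0, h⟩, Sum.inr j) : N.ChiIdx) :=
      fun a b hab => by simpa using hab
    rw [dotProduct, ← Finset.sum_image (f := fun c : N.ChiIdx => v c * v c)
      (g := fun j : Fin p₂ => ((⟨0, h⟩, Sum.inr j) : N.ChiIdx)) hinj.injOn]
    exact Finset.sum_le_sum_of_subset_of_nonneg (Finset.subset_univ _)
      fun c _ _ => mul_self_nonneg _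
  rw [star_trivial, sub_mulVec, one_mulVec, dotProduct_sub, h1]
  linarith

/-- The innovation of each agent is a function of the estimation errors alone. -/
theorem innovation_eq (R : N.Reduction) (h : 0 < N.nbar) (G : LeaderFollowerGraph n)
    (x : ∀ i, Fin (N.nx i) → ℝ) (w : ∀ i, Fin (N.nw i) → ℝ) (x₀ : Fin N.n₀ → ℝ) (i : Fin n)
    (z : Fin n → N.ChiIdx → ℝ) :
    Sum.elim (N.Cs i *ᵥ x i + N.Cw i *ᵥ w i) (relSum G (N.yd x x₀) i) -
        Sum.elim (N.calC.submatrix Sum.inl id *ᵥ z i) (relSum G (N.yhat z) i) =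
      selS p₁ p₂ *ᵥ (N.calC *ᵥ (R.chi i (x i) (w i) x₀ - z i)) +
        ∑ j, G.laplacian i j •
          (selD p₁ p₂ *ᵥ (N.calC *ᵥ (R.chi j (x j) (w j) x₀ - z j))) := by
  have hsub : ∀ j, N.calC *ᵥ (R.chi j (x j) (w j) x₀ - z j) =
      Sum.elim (N.Cs j *ᵥ x j + N.Cw j *ᵥ w j) (N.Cd j *ᵥ x j - N.C₀ *ᵥ x₀) -
        N.calC *ᵥ z j := fun j => by
    rw [mulVec_sub, calC_mulVec_chi R h]
  simp only [hsub, relSum_eq]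
  ext (a | a)
  · simp [selS, selD, fromBlocks_mulVec, calC_mulVec_apply h, Finset.sum_apply]
    exact calC_mulVec_apply h (z i) (Sum.inl a)
  · simp [selS, selD, fromBlocks_mulVec, yd, yhat, Finset.sum_apply]
    rw [← Finset.sum_sub_distrib]
    refine Finset.sum_congr rfl fun j _ => ?_
    rw [← mul_sub]
    rfl

/-- Right-hand side of the differential equation of the estimation error of agent `i`. -/
noncomputable def errorDrift (L : Fin n → Matrix (Fin p₁ ⊕ Fin p₂) N.ChiIdx ℝ)
    (P : Matrix N.ChiIdx N.ChiIdx ℝ) (ε : ℝ) (G : LeaderFollowerGraph n)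
    (e : Fin n → N.ChiIdx → ℝ) (i : Fin n) : N.ChiIdx → ℝ :=
  (N.calA + N.calL (L i)) *ᵥ e i -
    (N.gainS ε * P * N.calCᵀ) *ᵥ (selS p₁ p₂ *ᵥ (N.calC *ᵥ e i) +
      ∑ j, G.laplacian i j • (selD p₁ p₂ *ᵥ (N.calC *ᵥ e j)))

theorem error_dynamics (R : N.Reduction) (h : 0 < N.nbar)
    {L : Fin n → Matrix (Fin p₁ ⊕ Fin p₂) N.ChiIdx ℝ}
    (hL : ∀ i, R.T i * R.Abar i = (N.calA + N.calL (L i)) * R.T i)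
    (P : Matrix N.ChiIdx N.ChiIdx ℝ) (ε : ℝ) (G : LeaderFollowerGraph n)
    (x : ∀ i, Fin (N.nx i) → ℝ) (w : ∀ i, Fin (N.nw i) → ℝ) (x₀ : Fin N.n₀ → ℝ) (i : Fin n)
    (u : Fin (N.nu i) → ℝ) (z : Fin n → N.ChiIdx → ℝ) :
    R.chi i (N.A i *ᵥ x i + N.B i *ᵥ u) (N.S i *ᵥ w i) (N.A₀ *ᵥ x₀) -
        N.observerRHS R L P ε G x w x₀ i u z =
      errorDrift L P ε G (fun j => R.chi j (x j) (w j) x₀ - z j) i := by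
  rw [R.chi_dynamics hL, observerRHS, innovation_eq R h, errorDrift,
    mulVec_sub (N.calA + N.calL (L i))]
  abel

/-- The stacked error in the coordinates `S(ε)⁻¹ eᵢ`. -/
noncomputable def scaledError (ε : ℝ) (e : Fin n → N.ChiIdx → ℝ) : Fin n × N.ChiIdx → ℝ :=
  fun a => ε ^ ((a.2.1 : ℕ) + 1) * e a.1 a.2

/-- The block diagonal matrix with blocks `S(ε)⁻¹ ℒᵢ S(ε)`. -/
noncomputable def scaledL (L : Fin n → Matrix (Fin p₁ ⊕ Fin p₂) N.ChiIdx ℝ) (ε : ℝ) :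
    Matrix (Fin n × N.ChiIdx) (Fin n × N.ChiIdx) ℝ :=
  Matrix.of fun a b => if a.1 = b.1 then
    ε ^ ((a.2.1 : ℕ) + 1) * N.calL (L a.1) a.2 b.2 * (ε ^ ((b.2.1 : ℕ) + 1))⁻¹ else 0

/-- The state matrix of the stacked error in the coordinates `S(ε)⁻¹ eᵢ`. -/
noncomputable def errorMatrix (L : Fin n → Matrix (Fin p₁ ⊕ Fin p₂) N.ChiIdx ℝ)
    (P : Matrix N.ChiIdx N.ChiIdx ℝ) (ε : ℝ) (M : Matrix (Fin n) (Fin n) ℝ) :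
    Matrix (Fin n × N.ChiIdx) (Fin n × N.ChiIdx) ℝ :=
  ε⁻¹ • ((1 : Matrix (Fin n) (Fin n) ℝ) ⊗ₖ N.calA
    - (1 : Matrix (Fin n) (Fin n) ℝ) ⊗ₖ (P * N.outerS) - M ⊗ₖ (P * N.outerD)) + scaledL L ε

/-- `ℒᵢ` only has a last block row, which `S(ε)⁻¹` shrinks the most, so the scaled
blocks do not grow as `ε → 0`. -/
theorem abs_scaledL_le (L : Fin n → Matrix (Fin p₁ ⊕ Fin p₂) N.ChiIdx ℝ) {ε : ℝ} (hε : 0 < ε)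
    (hε1 : ε ≤ 1) (a b : Fin n × N.ChiIdx) :
    |scaledL L ε a b| ≤ |N.calL (L a.1) a.2 b.2| := by
  rw [scaledL, of_apply]
  split_ifs with hab
  · by_cases ha : (a.2.1 : ℕ) + 1 = N.nbar
    · rw [mul_right_comm, abs_mul]
      refine mul_le_of_le_one_left (abs_nonneg _) ?_
      rw [abs_of_nonneg (by positivity), ← div_eq_mul_inv, div_le_one (by positivity)]
      exact pow_le_pow_of_le_one hε.le hε1 (by omega)
    · simp [calL, ha]
  · rw [abs_zero]
    exact abs_nonneg _

theorem kronecker_mulVec_apply {ι κ : Type} [Fintype ι] [Fintype κ] (M : Matrix ι ι ℝ)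
    (B : Matrix κ κ ℝ) (ξ : ι × κ → ℝ) (i : ι) (b : κ) :
    ((M ⊗ₖ B) *ᵥ ξ) (i, b) = ∑ j, M i j * (B *ᵥ fun c => ξ (j, c)) b := by
  simp only [mulVec, dotProduct, kronecker_apply, Fintype.sum_prod_type, Finset.mul_sum, mul_assoc]

/-- `S(ε)⁻¹ 𝒜 S(ε) = ε⁻¹ 𝒜`. -/
theorem calA_mulVec_scaled {ε : ℝ} (hε : ε ≠ 0) (e : N.ChiIdx → ℝ) (b : N.ChiIdx) :
    ε⁻¹ * (N.calA *ᵥ fun c => ε ^ ((c.1 : ℕ) + 1) * e c) b =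
      ε ^ ((b.1 : ℕ) + 1) * (N.calA *ᵥ e) b := by
  simp only [mulVec, dotProduct, Finset.mul_sum]
  refine Finset.sum_congr rfl fun c _ => ?_
  by_cases h : (c.1 : ℕ) = b.1 + 1 ∧ c.2 = b.2
  · rw [h.1, pow_succ ε ((b.1 : ℕ) + 1)]
    field_simp
  · simp [calA, h]

/-- `𝒞 S(ε) = ε⁻¹ 𝒞`, applied to `S(ε)⁻¹ e`. -/
theorem calC_mulVec_scaled (h : 0 < N.nbar) (ε : ℝ) (e : N.ChiIdx → ℝ) :
    (N.calC *ᵥ fun c => ε ^ ((c.1 : ℕ) + 1) * e c) = ε • (N.calC *ᵥ e) := by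
  ext j
  simp [calC_mulVec_apply h]

/-- `errorMatrix` is the error dynamics in the scaled coordinates. -/
theorem errorMatrix_mulVec (h : 0 < N.nbar) (L : Fin n → Matrix (Fin p₁ ⊕ Fin p₂) N.ChiIdx ℝ)
    (P : Matrix N.ChiIdx N.ChiIdx ℝ) {ε : ℝ} (hε : ε ≠ 0) (G : LeaderFollowerGraph n)
    (e : Fin n → N.ChiIdx → ℝ) :
    errorMatrix L P ε G.laplacian *ᵥ scaledError ε e =
      scaledError ε (errorDrift L P ε G e) := by
  ext ⟨i, b⟩
  have hL : (scaledL L ε *ᵥ scaledError ε e) (i, b) =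
      ε ^ ((b.1 : ℕ) + 1) * (N.calL (L i) *ᵥ e i) b := by
    simp only [mulVec, dotProduct, Fintype.sum_prod_type (α₁ := Fin n), scaledL, of_apply,
      scaledError, ite_mul, zero_mul]
    rw [Finset.sum_eq_single i]
    · simp only [if_true, Finset.mul_sum]
      refine Finset.sum_congr rfl fun c _ => ?_
      have : ε ^ ((c.1 : ℕ) + 1) ≠ 0 := pow_ne_zero _ hε
      field_simp
    · intro j _ hj
      simp [hj.symm]
    · simp
  have hgain : ∀ y, ε ^ ((b.1 : ℕ) + 1) * ((N.gainS ε * P * N.calCᵀ) *ᵥ y) b =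
      ((P * N.calCᵀ) *ᵥ y) b := by
    intro y
    rw [Matrix.mul_assoc, ← mulVec_mulVec, gainS, mulVec_diagonal, ← mul_assoc,
      mul_inv_cancel₀ (pow_ne_zero _ hε), one_mul]
  have hS : ∀ (X : Matrix (Fin p₁ ⊕ Fin p₂) (Fin p₁ ⊕ Fin p₂) ℝ) j,
      ε⁻¹ * ((P * (N.calCᵀ * X * N.calC)) *ᵥ fun c => scaledError ε e (j, c)) b =
        ((P * N.calCᵀ) *ᵥ (X *ᵥ (N.calC *ᵥ e j))) b := by
    intro X j
    have e1 : P * (N.calCᵀ * X * N.calC) = P * N.calCᵀ * X * N.calC := by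
      simp only [Matrix.mul_assoc]
    rw [e1, ← mulVec_mulVec]
    simp only [scaledError]
    rw [calC_mulVec_scaled h, mulVec_smul, Pi.smul_apply, smul_eq_mul, inv_mul_cancel_left₀ hε]
    simp only [mulVec_mulVec, Matrix.mul_assoc]
  have hone : ∀ B : Matrix N.ChiIdx N.ChiIdx ℝ,
      (((1 : Matrix (Fin n) (Fin n) ℝ) ⊗ₖ B) *ᵥ scaledError ε e) (i, b) =
        (B *ᵥ fun c => scaledError ε e (i, c)) b := by
    intro B
    rw [kronecker_mulVec_apply, Finset.sum_eq_single i]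
    · simp
    · intro j _ hj
      simp [Matrix.one_apply_ne hj.symm]
    · simp
  rw [errorMatrix, add_mulVec, Pi.add_apply, hL, smul_mulVec, sub_mulVec, sub_mulVec,
    Pi.smul_apply, Pi.sub_apply, Pi.sub_apply, hone, hone, kronecker_mulVec_apply, smul_eq_mul,
    mul_sub, mul_sub, outerS, hS, Finset.mul_sum]
  simp only [mul_left_comm ε⁻¹, outerD, hS]
  have hA := calA_mulVec_scaled hε (e i) b
  rw [show (fun c => scaledError ε e (i, c)) = fun c : N.ChiIdx => ε ^ ((c.1 : ℕ) + 1) * e i c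
    from rfl, hA]
  simp only [scaledError, errorDrift, Pi.sub_apply, mul_sub, hgain, add_mulVec, Pi.add_apply,
    mul_add, mulVec_add, mulVec_sum, mulVec_smul, Finset.sum_apply, Pi.smul_apply, smul_eq_mul,
    Finset.mul_sum, mul_left_comm (ε ^ ((b.1 : ℕ) + 1)) (G.laplacian _ _)]
  ring

theorem scaledError_solves (R : N.Reduction) (h : 0 < N.nbar)
    {L : Fin n → Matrix (Fin p₁ ⊕ Fin p₂) N.ChiIdx ℝ}
    (hL : ∀ i, R.T i * R.Abar i = (N.calA + N.calL (L i)) * R.T i)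
    (P : Matrix N.ChiIdx N.ChiIdx ℝ) {ε : ℝ} (hε : ε ≠ 0) {t₀ : ℝ} (G : ℝ → LeaderFollowerGraph n)
    {x : ∀ i, ℝ → Fin (N.nx i) → ℝ} {w : ∀ i, ℝ → Fin (N.nw i) → ℝ}
    {x₀ : ℝ → Fin N.n₀ → ℝ} {u : ∀ i, ℝ → Fin (N.nu i) → ℝ}
    {χhat : Fin n → ℝ → N.ChiIdx → ℝ}
    (hx : ∀ i, SolvesFrom t₀ (x i) fun t => N.A i *ᵥ x i t + N.B i *ᵥ u i t)
    (hw : ∀ i, SolvesFrom t₀ (w i) fun t => N.S i *ᵥ w i t)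
    (hx₀ : SolvesFrom t₀ x₀ (fun t => N.A₀ *ᵥ x₀ t))
    (hχ : ∀ i, SolvesFrom t₀ (χhat i) fun t =>
        N.observerRHS R L P ε (G t) (fun j => x j t) (fun j => w j t) (x₀ t) i (u i t)
          fun j => χhat j t) :
    SolvesFrom t₀ (fun t => scaledError ε fun i => R.chi i (x i t) (w i t) (x₀ t) - χhat i t)
      fun t => errorMatrix L P ε (G t).laplacian *ᵥ
        scaledError ε fun i => R.chi i (x i t) (w i t) (x₀ t) - χhat i t := by
  have herr : ∀ i, SolvesFrom t₀ (fun t => R.chi i (x i t) (w i t) (x₀ t) - χhat i t) fun t =>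
      errorDrift L P ε (G t) (fun j => R.chi j (x j t) (w j t) (x₀ t) - χhat j t) i := by
    intro i
    have h1 := ((((hx i).sumElim ((hw i).sumElim hx₀)).mulVec (R.W i)).mulVec (R.T i)).sub (hχ i)
    have h2 := fun t => error_dynamics R h hL P ε (G t) (fun j => x j t) (fun j => w j t) (x₀ t) i
      (u i t) fun j => χhat j t
    simp only [← h2]
    exact h1
  simp only [errorMatrix_mulVec h L P hε]
  rw [solvesFrom_iff]
  rintro ⟨i, b⟩ t ht
  obtain ⟨h1, h2⟩ := solvesFrom_iff.mp (herr i) b t ht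
  refine ⟨h1.const_mul _, ?_⟩
  simp only [scaledError]
  rw [intervalIntegral.integral_const_mul, ← mul_add, ← h2]

end AgentNetwork

/-! ### Convergence of the observer -/

theorem lemma3 {n p₁ p₂ δ : ℕ} (N : AgentNetwork n p₁ p₂) (hobs : N.Observable)
    -- the transformation removing redundant modes, and `L` with `χ̇ᵢ = (𝒜 + ℒᵢ) χᵢ + ℬᵢ uᵢ`
    (R : N.Reduction) (L : Fin n → Matrix (Fin p₁ ⊕ Fin p₂) N.ChiIdx ℝ)
    (hL : ∀ i, R.T i * R.Abar i = (N.calA + N.calL (L i)) * R.T i)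
    -- the communication graphs
    (G : Fin δ → LeaderFollowerGraph n) (Γc : Finset (Fin δ)) (hΓc : Γc.Nonempty)
    (htree : ∀ k ∈ Γc, (G k).HasLeaderTree)
    -- the numbers `β k` and `θ = min β k`
    (β : Fin δ → ℝ)
    (hβ : ∀ k ∈ Γc, 0 < β k ∧
      ∀ μ ∈ spectrum ℂ ((G k).laplacian.map (algebraMap ℝ ℂ)), β k < μ.re)
    (θ : ℝ) (hθ : θ = Γc.inf' hΓc β)
    -- the gain matrix
    (P : Matrix N.ChiIdx N.ChiIdx ℝ) (hP : P.PosDef) (hric : N.Riccati θ P)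
    -- the dwell time and the ratio of activation times
    (τd : ℝ) (hτd : 0 < τd) (α κ : ℝ) (hα : α ∈ Set.Ioo (0 : ℝ) 1) (hκpos : 0 < κ)
    (hκ : (α + 4 * max θ 1 * lambdaMax P ^ 2) / (1 - α) ≤ κ) :
    ∃ εs ∈ Set.Ioc (0 : ℝ) 1, ∀ ε ∈ Set.Ioc (0 : ℝ) εs,
      ∀ (t₀ : ℝ) (σ : ℝ → Fin δ), HasDwellTime σ t₀ τd →
      (∃ s, t₀ ≤ s ∧ ∀ t, s ≤ t →
        κ * activationTime σ {k | k ∉ Γc} s t ≤ activationTime σ {k | k ∈ Γc} s t) →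
      ∀ (x : ∀ i, ℝ → Fin (N.nx i) → ℝ) (w : ∀ i, ℝ → Fin (N.nw i) → ℝ)
        (x₀ : ℝ → Fin N.n₀ → ℝ) (u : ∀ i, ℝ → Fin (N.nu i) → ℝ)
        (χhat : Fin n → ℝ → N.ChiIdx → ℝ),
      (∀ i, SolvesFrom t₀ (x i) fun t => N.A i *ᵥ x i t + N.B i *ᵥ u i t) →
      (∀ i, SolvesFrom t₀ (w i) fun t => N.S i *ᵥ w i t) →
      SolvesFrom t₀ x₀ (fun t => N.A₀ *ᵥ x₀ t) →
      (∀ i, SolvesFrom t₀ (χhat i) fun t =>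
        N.observerRHS R L P ε (G (σ t)) (fun j => x j t) (fun j => w j t) (x₀ t) i (u i t)
          fun j => χhat j t) →
      ∀ i, Tendsto (fun t => R.chi i (x i t) (w i t) (x₀ t) - χhat i t) atTop (𝓝 0) := by
  -- if `p n̄ = 0` there is nothing to estimate, and `lambdaMax P` is not meaningful
  rcases isEmpty_or_nonempty N.ChiIdx with hemp | hne
  · exact ⟨1, ⟨one_pos, le_rfl⟩, fun ε _ t₀ σ _ _ x w x₀ u χhat _ _ _ _ i =>
      tendsto_pi_nhds.mpr fun a => hemp.elim a⟩
  have hnbar : 0 < N.nbar := hne.elim fun a => a.1.pos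
  have hθ0 : 0 < θ := by
    rw [hθ, Finset.lt_inf'_iff]
    exact fun k hk => (hβ k hk).1
  have hθβ : ∀ k ∈ Γc, θ ≤ β k := fun k hk => hθ ▸ Finset.inf'_le β hk
  -- the level certified by the Lyapunov matrix of each graph
  set c : Fin δ → ℝ := fun k => if k ∈ Γc then θ else -1 with hc
  have hlyap : ∀ k, ∃ Q : Matrix (Fin n) (Fin n) ℝ, Q.PosDef ∧
      (Q * (G k).laplacian + (G k).laplacianᵀ * Q - (2 * c k) • Q).PosSemidef := by
    intro k
    refine exists_posDef_lyapunov _ _ fun μ hμ => ?_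
    by_cases hk : k ∈ Γc
    · simp only [hc, hk, if_true]
      exact (hθβ k hk).trans_lt ((hβ k hk).2 μ hμ)
    · simp only [hc, hk, if_false]
      linarith [laplacian_spectrum_re_nonneg (G k) μ hμ]
  choose Q hQ hQM using hlyap
  set X : Fin δ → Matrix (Fin n × N.ChiIdx) (Fin n × N.ChiIdx) ℝ := fun k => Q k ⊗ₖ P⁻¹ with hXdef
  have hX : ∀ k, (X k).PosDef := fun k => (hQ k).kronecker hP.inv
  obtain ⟨μ, hμ, hXμ⟩ := exists_uniform_comparison X hX
  choose c₁ hc₁ hpert using fun k => (hX k).exists_perturbation_bound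
    (Matrix.of fun a b => |N.calL (L a.1) a.2 b.2|)
  set c₀ : ℝ := ∑ k, c₁ k with hc₀
  have hc₀0 : 0 ≤ c₀ := Finset.sum_nonneg fun k _ => hc₁ k
  have hc₁₀ : ∀ k, c₁ k ≤ c₀ := fun k =>
    Finset.single_le_sum (f := c₁) (fun k _ => hc₁ k) (Finset.mem_univ k)
  set lam : ℝ := lambdaMax P with hlamdef
  have hlam : 0 < lam := lambdaMax_pos hP
  have hPlam := posSemidef_lambdaMax_smul_one_sub hP.isHermitian
  have hPT : Pᵀ = P := by
    rw [← conjTranspose_eq_transpose_of_trivial]; exact hP.isHermitian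
  have hu : IsUnit P.det := (isUnit_iff_isUnit_det _).mp hP.isUnit
  have hric' : N.calA * P + P * N.calAᵀ -
      (2 : ℝ) • (P * (N.outerS + θ • N.outerD) * P) + 1 = 0 := by
    rw [← AgentNetwork.calC_weight, ← hric]
    simp only [Matrix.mul_assoc]
  have hlog : 0 ≤ Real.log μ / τd := div_nonneg (Real.log_nonneg hμ) hτd.le
  set D : ℝ := lam * (c₀ + Real.log μ / τd + 1) with hD
  have hDpos : 0 < D := by positivity
  -- below `α / D` the decay rate `α / (ε lam) - c₀` exceeds `log μ / τd`
  refine ⟨min 1 (α / D), ⟨lt_min one_pos (div_pos hα.1 hDpos), min_le_left _ _⟩, ?_⟩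
  rintro ε ⟨hε, hεs⟩ t₀ σ hσ hratio x w x₀ u χhat hx hw hx₀ hχ i
  have hε1 : ε ≤ 1 := hεs.trans (min_le_left _ _)
  have hεD : ε ≤ α / D := hεs.trans (min_le_right _ _)
  set m : ℝ := max θ 1 with hm
  have hm1 : 1 ≤ m := le_max_right _ _
  have hmθ : θ ≤ m := le_max_left _ _
  have hV : ∀ k v, v ⬝ᵥ (X k * AgentNetwork.errorMatrix L P ε (G k).laplacian +
      (AgentNetwork.errorMatrix L P ε (G k).laplacian)ᵀ * X k) *ᵥ v ≤
      v ⬝ᵥ (ε⁻¹ • ((2 * (θ - c k)) • (Q k ⊗ₖ N.outerD) - Q k ⊗ₖ (P⁻¹ * P⁻¹) -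
        (Q k * (G k).laplacian + (G k).laplacianᵀ * Q k - (2 * c k) • Q k) ⊗ₖ N.outerD)) *ᵥ v +
      c₀ * (v ⬝ᵥ X k *ᵥ v) := by
    intro k v
    rw [hXdef, AgentNetwork.errorMatrix, kronecker_lyapunov_identity (c k) ε _ hu hPT
      AgentNetwork.outerS_transpose AgentNetwork.outerD_transpose hric', add_mulVec, dotProduct_add]
    have h0 : 0 ≤ v ⬝ᵥ X k *ᵥ v := by
      simpa using (hX k).posSemidef.dotProduct_mulVec_nonneg v
    have h1 := hpert k (AgentNetwork.scaledL L ε) (AgentNetwork.abs_scaledL_le L hε hε1) v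
    have h2 := mul_le_mul_of_nonneg_right (hc₁₀ k) h0
    have h3 := h1.trans h2
    simp only [hXdef] at h3
    linarith
  have hXK : ∀ k ∈ Γc, ∀ v, v ⬝ᵥ (X k * AgentNetwork.errorMatrix L P ε (G k).laplacian +
      (AgentNetwork.errorMatrix L P ε (G k).laplacian)ᵀ * X k) *ᵥ v ≤
      -(1 / (ε * lam) - c₀) * (v ⬝ᵥ X k *ᵥ v) := by
    intro k hk v
    have hck : c k = θ := by simp only [hc, hk, if_true]
    have h1 := connected_rate hε hlam hP hPlam (hQ k) (hQM k)
      (AgentNetwork.outerD_posSemidef (N := N)) v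
    have h2 := hV k v
    rw [hck, sub_self, mul_zero] at h2
    rw [hck] at h1
    linarith
  have hXK' : ∀ k ∉ Γc, ∀ v, v ⬝ᵥ (X k * AgentNetwork.errorMatrix L P ε (G k).laplacian +
      (AgentNetwork.errorMatrix L P ε (G k).laplacian)ᵀ * X k) *ᵥ v ≤
      (4 * m * lam / ε + c₀) * (v ⬝ᵥ X k *ᵥ v) := by
    intro k hk v
    have hck : c k = -1 := by simp only [hc, hk, if_false]
    have h1 := disconnected_rate hε hlam (g := 2 * (θ - c k)) (by rw [hck]; linarith) hP hPlam
      (hQ k) (hQM k) AgentNetwork.outerD_posSemidef (AgentNetwork.one_sub_outerD_posSemidef hnbar) v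
    have h0 : 0 ≤ v ⬝ᵥ X k *ᵥ v := by
      simpa using (hX k).posSemidef.dotProduct_mulVec_nonneg v
    have h2 : 2 * (θ - c k) * lam / ε ≤ 4 * m * lam / ε := by
      have : 2 * (θ - c k) ≤ 4 * m := by rw [hck]; linarith
      gcongr
    have h3 := mul_le_mul_of_nonneg_right h2 h0
    have h4 := hV k v
    have h5 := h4.trans (add_le_add_left (h1.trans h3) _)
    linarith
  have hεlam : 0 < ε * lam := mul_pos hε hlam
  have hsol := AgentNetwork.scaledError_solves R hnbar hL P hε.ne' (fun t => G (σ t)) hx hw hx₀ hχ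
  have hρ : Real.log μ / τd < α / (ε * lam) - c₀ := by
    have h1 : ε * D ≤ α := (le_div_iff₀ hDpos).mp hεD
    rw [lt_sub_iff_add_lt, lt_div_iff₀ hεlam]
    rw [hD] at h1
    nlinarith
  have hρa : α / (ε * lam) - c₀ ≤ 1 / (ε * lam) - c₀ := by
    have := hα.2.le
    gcongr
  have hκ' : 4 * m * lam / ε + c₀ + (α / (ε * lam) - c₀) ≤
      (1 / (ε * lam) - c₀ - (α / (ε * lam) - c₀)) * κ := by
    have h1 : α + 4 * m * lam ^ 2 ≤ κ * (1 - α) :=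
      (div_le_iff₀ (by linarith [hα.2])).mp hκ
    have e1 : 4 * m * lam / ε + c₀ + (α / (ε * lam) - c₀) =
        (α + 4 * m * lam ^ 2) / (ε * lam) := by
      field_simp
      ring
    have e2 : (1 / (ε * lam) - c₀ - (α / (ε * lam) - c₀)) * κ = κ * (1 - α) / (ε * lam) := by
      field_simp
      ring
    rw [e1, e2]
    gcongr
  have hlim := tendsto_zero_of_switched (A := {k | k ∈ Γc})
    (K := fun k => AgentNetwork.errorMatrix L P ε (G k).laplacian) hX hμ hXμ hXK hXK' hτd
    hρ hρa hκ' hσ hratio hsol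
  rw [tendsto_pi_nhds] at hlim ⊢
  intro b
  have h1 := (hlim (i, b)).const_mul (ε ^ ((b.1 : ℕ) + 1))⁻¹
  simp only [AgentNetwork.scaledError, Pi.zero_apply, mul_zero,
    inv_mul_cancel_left₀ (pow_ne_zero ((b.1 : ℕ) + 1) hε.ne')] at h1
  exact h1
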